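/- Let $k\ge 1$ be a fixed integer. For integers $n\ge 1$, $P\ge 0$ and $p\in[0,1]$, the binomial random intersection graph $G_b(n,P,p)$ is the random graph on $n$ nodes $v_1,\dots,v_n$ obtained as follows: each node $v_i$ receives a random subset $S_i$ of a fixed pool of $P$ objects, where each object is put into $S_i$ with probability $p$, independently over all objects and all nodes, and two distinct nodes $v_i,v_j$ are joined by an edge if and only if $S_i\cap S_j\neq\emptyset$. A graph with node set $\mathcal V$ is called $k$-robust if for every non-empty strict subset $T$ of $\mathcal V$ at least one of the following holds: (a) some node of $T$ has at least $k$ neighbors in $\mathcal V\setminus T$; (b) some node of $\mathcal V\setminus T$ has at least $k$ neighbors in $T$. Let $P_n\ge 0$ be integers and $p_n\in[0,1]$, and let the sequence $\alpha_n$ be defined for all $n\ge 2$ through $$p_n^2P_n=\frac{\ln n+(k-1)\ln\ln n+\alpha_n}{n}.$$ If $P_n=\Omega\big(n(\ln n)^5\big)$ and $|\alpha_n|=o(\ln n)$ as $n\to\infty$, then $$\lim_{n\to\infty}\mathbb P\big[G_b(n,P_n,p_n)\text{ is }k\text{-robust}\big]=\begin{cases}0,&\text{if }\lim_{n\to\infty}\alpha_n=-\infty,\\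 1,&\text{if }\lim_{n\to\infty}\alpha_n=\infty.\end{cases}$$ -/

import Mathlib

open Filter Topology MeasureTheory Asymptotics

/-- The intersection graph of a family of object sets `S i`, one for each node `i`:
two distinct nodes are adjacent iff their object sets share at least one object. -/
def objectIntersectionGraph {V O : Type*} (S : V → Set O) : SimpleGraph V where
  Adj i j := i ≠ j ∧ (S i ∩ S j).Nonempty
  symm := ⟨fun _ _ h => ⟨h.1.symm, by rw [Set.inter_comm]; exact h.2⟩⟩
  loopless := ⟨fun _ h => h.1 rfl⟩

/-- A graph with node set `V` is `k`-robust if for every non-empty strict subset `T` of `V`, some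
node of `T` has at least `k` neighbors in `V \ T`, or some node of `V \ T` has at least `k`
neighbors in `T`. -/
def IsKRobust {V : Type*} (k : ℕ) (G : SimpleGraph V) : Prop :=
  ∀ T : Set V, T.Nonempty → T ≠ Set.univ →
    (∃ a ∈ T, (k : ℕ∞) ≤ (G.neighborSet a ∩ Tᶜ).encard) ∨
    (∃ b ∈ Tᶜ, (k : ℕ∞) ≤ (G.neighborSet b ∩ T).encard)

/-- The joint law of the object sets `S_1, …, S_n` of the binomial random intersection graph with
`n` nodes and an object pool of size `P`: the sets are independent, and each of them contains each
object of the pool independently with probability `p`. -/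
noncomputable def binomialObjectSets (n P : ℕ) (p : unitInterval) :
    Measure (Fin n → Set (Fin P)) :=
  Measure.pi fun _ : Fin n => ProbabilityTheory.setBernoulli (Set.univ : Set (Fin P)) p

/-- The probability that the binomial random intersection graph `G_b(n, P, p)` is `k`-robust. -/
noncomputable def probBinomialRIGRobust (k n P : ℕ) (p : unitInterval) : ℝ :=
  (binomialObjectSets n P p).real {S | IsKRobust k (objectIntersectionGraph S)}

/-! Write `L = n p² P` for the approximate mean degree. Since `n L^(k-1) e^(-L) = (L / ln n)^(k-1)
e^(-α)` and `L ~ ln n` (`exp_neg_meanDegree`), this quantity, which is of the order of the expected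
number of nodes of degree `k - 1`, tends to `∞` or to `0` according to the sign of the limit of `α`.
The assumption on the pool size enters through `n p L → 0`.

Zero law: a node that shares exactly `k - 1` objects, each with exactly one other node, has degree
below `k`, and then the singleton of that node violates robustness
(`shareCount_eq_zero_of_isKRobust`). Viewed from the objects, the holder sets are independent random
subsets of the nodes, so all moments factor over objects, and a second moment argument
(`familyExp_shareCount_eq_zero_le`) shows that such a node exists with high probability.

One law: if robustness fails, some `T` with at most half of the nodes consists of nodes with fewer
than `k` neighbors outside `T`. Dependence between edges is removed by keeping only private objects
of outside nodes, those held by no other outside node: these sets are disjoint and fixed once the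
outside object sets are known. Each `v ∈ T` hits fewer than `k` of them, which an exponential moment
with parameter `z = 1/L` bounds by about `L^(k-1) e^(-L)`, independently over `T`. The private sets
are large enough for every `T` at once, outside a single event whose probability is bounded by
Markov's inequality (`fluctuation`). A union bound over `T` then gives a geometric series
(`sum_finset_pow_le`) with ratio a constant times `n L^(k-1) e^(-L)`. -/

/-- The probability that a random subset of a finite set, containing each element independently
with probability `p`, equals `s`. -/
noncomputable def bernWeight {O : Type*} [Fintype O] [DecidableEq O] (p : ℝ) (s : Finset O) : ℝ :=
  ∏ o, if o ∈ s then p else 1 - p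

/-- The expectation of `f` at a `p`-random subset. -/
noncomputable def bernExp {O : Type*} [Fintype O] [DecidableEq O] (p : ℝ) (f : Finset O → ℝ) : ℝ :=
  ∑ s, bernWeight p s * f s

/-- The expectation of `F` at a family of independent `p`-random subsets. -/
noncomputable def familyExp {V O : Type*} [Fintype V] [DecidableEq V] [Fintype O] [DecidableEq O]
    (p : ℝ) (F : (V → Finset O) → ℝ) : ℝ :=
  ∑ S, (∏ v, bernWeight p (S v)) * F S

/-! ### Finite calculus of independent `p`-random subsets. -/

section BernoulliSets

variable {V O : Type*} [Fintype V] [DecidableEq V] [Fintype O] [DecidableEq O]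

theorem bernWeight_nonneg {p : ℝ} (h0 : 0 ≤ p) (h1 : p ≤ 1) (s : Finset O) :
    0 ≤ bernWeight p s :=
  Finset.prod_nonneg fun o _ => by split_ifs <;> linarith

/-- Expanding the product over all choices of objects inside or outside the random set gives
independence across objects; the probabilities of containment and avoidance below come from this
identity. -/
theorem bernExp_prod_ite (p : ℝ) (a b : O → ℝ) :
    bernExp p (fun s => ∏ o, if o ∈ s then a o else b o) = ∏ o, (p * a o + (1 - p) * b o) := by
  rw [Finset.prod_add, bernExp, Finset.powerset_univ]
  refine Finset.sum_congr rfl fun s _ => ?_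
  rw [bernWeight, ← Finset.prod_mul_distrib, ← Finset.prod_mul_prod_compl s]
  congr 1
  · exact Finset.prod_congr rfl fun o ho => by simp [ho]
  · rw [Finset.compl_eq_univ_sdiff]
    refine Finset.prod_congr rfl fun o ho => ?_
    have : o ∉ s := by simpa using ho
    simp [this]

theorem bernExp_one (p : ℝ) : bernExp p (fun _ : Finset O => 1) = 1 := by
  have := bernExp_prod_ite (O := O) p (fun _ => 1) (fun _ => 1)
  simpa using this

theorem bernExp_add (p : ℝ) (f g : Finset O → ℝ) :
    bernExp p (fun s => f s + g s) = bernExp p f + bernExp p g := by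
  simp [bernExp, mul_add, Finset.sum_add_distrib]

theorem bernExp_const_mul (p a : ℝ) (f : Finset O → ℝ) :
    bernExp p (fun s => a * f s) = a * bernExp p f := by
  rw [bernExp, bernExp, Finset.mul_sum]
  exact Finset.sum_congr rfl fun s _ => by ring

theorem bernExp_const (p a : ℝ) : bernExp p (fun _ : Finset O => a) = a := by
  have := bernExp_const_mul (O := O) p a (fun _ => 1)
  rw [bernExp_one] at this
  simpa using this

theorem bernExp_sum {ι : Type*} (p : ℝ) (t : Finset ι) (f : ι → Finset O → ℝ) :
    bernExp p (fun s => ∑ i ∈ t, f i s) = ∑ i ∈ t, bernExp p (f i) := by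
  simp only [bernExp, Finset.mul_sum]
  exact Finset.sum_comm

theorem bernExp_mono {p : ℝ} (h0 : 0 ≤ p) (h1 : p ≤ 1) {f g : Finset O → ℝ}
    (h : ∀ s, f s ≤ g s) : bernExp p f ≤ bernExp p g :=
  Finset.sum_le_sum fun s _ => mul_le_mul_of_nonneg_left (h s) (bernWeight_nonneg h0 h1 s)

theorem bernExp_nonneg {p : ℝ} (h0 : 0 ≤ p) (h1 : p ≤ 1) {f : Finset O → ℝ}
    (h : ∀ s, 0 ≤ f s) : 0 ≤ bernExp p f :=
  Finset.sum_nonneg fun s _ => mul_nonneg (bernWeight_nonneg h0 h1 s) (h s)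

/-- The probability that a random subset contains `A` and avoids `B`. -/
theorem bernExp_subset_disjoint (p : ℝ) (A B : Finset O) (hAB : Disjoint A B) :
    bernExp p (fun s => if A ⊆ s ∧ Disjoint s B then 1 else 0)
      = p ^ A.card * (1 - p) ^ B.card := by
  have h := bernExp_prod_ite p (fun o => if o ∈ B then 0 else 1) (fun o => if o ∈ A then 0 else 1)
  have e : (fun s : Finset O => if A ⊆ s ∧ Disjoint s B then (1 : ℝ) else 0) =
      fun s => ∏ o, if o ∈ s then (if o ∈ B then (0 : ℝ) else 1)
        else (if o ∈ A then 0 else 1) := by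
    funext s
    by_cases hs : A ⊆ s ∧ Disjoint s B
    · rw [if_pos hs, Finset.prod_eq_one]
      intro o _
      by_cases ho : o ∈ s
      · simp [ho, Finset.disjoint_left.1 hs.2 ho]
      · have : o ∉ A := fun h => ho (hs.1 h)
        simp [ho, this]
    · rw [if_neg hs]
      rw [not_and_or, Finset.not_subset, Finset.not_disjoint_iff] at hs
      symm
      rcases hs with ⟨o, h1, h2⟩ | ⟨o, h1, h2⟩
      · exact Finset.prod_eq_zero (Finset.mem_univ o) (by simp [h1, h2])
      · exact Finset.prod_eq_zero (Finset.mem_univ o) (by simp [h1, h2])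
  rw [e, h]
  have : ∀ o, (p * (if o ∈ B then (0 : ℝ) else 1) + (1 - p) * (if o ∈ A then (0 : ℝ) else 1)) =
      (if o ∈ A then p else 1) * (if o ∈ B then (1 - p) else 1) := by
    intro o
    by_cases h1 : o ∈ A
    · simp [h1, Finset.disjoint_left.1 hAB h1]
    · by_cases h2 : o ∈ B <;> simp [h1, h2]
  simp_rw [this]
  rw [Finset.prod_mul_distrib]
  simp

theorem bernExp_disjoint (p : ℝ) (B : Finset O) :
    bernExp p (fun s => if Disjoint s B then 1 else 0) = (1 - p) ^ B.card := by
  simpa using bernExp_subset_disjoint p ∅ B (by simp)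

theorem bernExp_subset (p : ℝ) (A : Finset O) :
    bernExp p (fun s => if A ⊆ s then 1 else 0) = p ^ A.card := by
  simpa using bernExp_subset_disjoint p A ∅ (by simp)

theorem bernExp_card (p : ℝ) :
    bernExp p (fun s : Finset O => (s.card : ℝ)) = Fintype.card O * p := by
  have e : (fun s : Finset O => (s.card : ℝ)) = fun s => ∑ o, if {o} ⊆ s then 1 else 0 := by
    funext s; simp
  rw [e, bernExp_sum]
  simp_rw [bernExp_subset]
  simp

theorem bernExp_card_sq (p : ℝ) :
    bernExp p (fun s : Finset O => (s.card : ℝ) ^ 2) =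
      Fintype.card O * p + Fintype.card O * (Fintype.card O - 1) * p ^ 2 := by
  have e : (fun s : Finset O => (s.card : ℝ) ^ 2) =
      fun s => ∑ o, ∑ o', if {o, o'} ⊆ s then 1 else 0 := by
    funext s
    simp only [Finset.insert_subset_iff, Finset.singleton_subset_iff, ite_and]
    simp [sq]
  have e2 : ∀ o o' : O, p ^ ({o, o'} : Finset O).card =
      p ^ 2 + if o = o' then p - p ^ 2 else 0 := by
    intro o o'
    by_cases h : o = o'
    · simp [h]
    · simp [h, Finset.card_pair h]
  rw [e, bernExp_sum]
  simp only [bernExp_sum, bernExp_subset, e2, Finset.sum_add_distrib]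
  simp
  ring

/-- The size is binomial, with variance `|O| p (1 - p)`. -/
theorem bernExp_card_sub_sq_le (p : ℝ) :
    bernExp p (fun s : Finset O => ((s.card : ℝ) - Fintype.card O * p) ^ 2) ≤
      Fintype.card O * p := by
  have e : (fun s : Finset O => ((s.card : ℝ) - Fintype.card O * p) ^ 2) =
      fun s => (s.card : ℝ) ^ 2 + ((-2 * (Fintype.card O * p)) * (s.card : ℝ)
        + (Fintype.card O * p) ^ 2) := by
    funext s; ring
  rw [e, bernExp_add, bernExp_add, bernExp_const_mul, bernExp_const, bernExp_card,
    bernExp_card_sq]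
  have : 0 ≤ (Fintype.card O : ℝ) * p ^ 2 := by positivity
  nlinarith

theorem familyExp_prod (p : ℝ) (f : V → Finset O → ℝ) :
    familyExp p (fun S => ∏ v, f v (S v)) = ∏ v, bernExp p (f v) := by
  simp only [familyExp, bernExp, ← Finset.prod_mul_distrib]
  rw [Finset.prod_univ_sum, Fintype.piFinset_univ]

theorem familyExp_one (p : ℝ) : familyExp p (fun _ : V → Finset O => 1) = 1 := by
  have := familyExp_prod (V := V) (O := O) p (fun _ _ => 1)
  simpa [bernExp_one] using this

theorem familyExp_add (p : ℝ) (F G : (V → Finset O) → ℝ) :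
    familyExp p (fun S => F S + G S) = familyExp p F + familyExp p G := by
  simp [familyExp, mul_add, Finset.sum_add_distrib]

theorem familyExp_const_mul (p a : ℝ) (F : (V → Finset O) → ℝ) :
    familyExp p (fun S => a * F S) = a * familyExp p F := by
  rw [familyExp, familyExp, Finset.mul_sum]
  exact Finset.sum_congr rfl fun s _ => by ring

theorem familyExp_const (p a : ℝ) : familyExp p (fun _ : V → Finset O => a) = a := by
  have := familyExp_const_mul (V := V) (O := O) p a (fun _ => 1)
  rw [familyExp_one] at this
  simpa using this

theorem familyExp_sum {ι : Type*} (p : ℝ) (t : Finset ι) (F : ι → (V → Finset O) → ℝ) :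
    familyExp p (fun S => ∑ i ∈ t, F i S) = ∑ i ∈ t, familyExp p (F i) := by
  simp only [familyExp, Finset.mul_sum]
  exact Finset.sum_comm

theorem familyExp_mono {p : ℝ} (h0 : 0 ≤ p) (h1 : p ≤ 1) {F G : (V → Finset O) → ℝ}
    (h : ∀ S, F S ≤ G S) : familyExp p F ≤ familyExp p G :=
  Finset.sum_le_sum fun S _ => mul_le_mul_of_nonneg_left (h S)
    (Finset.prod_nonneg fun v _ => bernWeight_nonneg h0 h1 (S v))

theorem familyExp_nonneg {p : ℝ} (h0 : 0 ≤ p) (h1 : p ≤ 1) {F : (V → Finset O) → ℝ}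
    (h : ∀ S, 0 ≤ F S) : 0 ≤ familyExp p F := by
  have := familyExp_mono h0 h1 h
  rwa [familyExp_const] at this

theorem familyExp_comp_apply (p : ℝ) (v : V) (f : Finset O → ℝ) :
    familyExp p (fun S : V → Finset O => f (S v)) = bernExp p f := by
  have h := familyExp_prod (V := V) p (fun u s => if u = v then f s else 1)
  have e : (fun S : V → Finset O => ∏ u, if u = v then f (S u) else 1) =
      fun S => f (S v) := by
    funext S; simp
  rw [e] at h
  rw [h, Finset.prod_eq_single v]
  · simp
  · intro u _ hu; simp [hu, bernExp_one]
  · simp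

theorem familyExp_card_inter (p : ℝ) {i j : V} (hij : i ≠ j) :
    familyExp p (fun S : V → Finset O => ((S i ∩ S j).card : ℝ)) = Fintype.card O * p ^ 2 := by
  have key : ∀ o : O, familyExp p (fun S : V → Finset O => if o ∈ S i ∩ S j then (1 : ℝ) else 0)
      = p ^ 2 := by
    intro o
    have h := familyExp_prod (V := V) p
      (fun u s => if u = i ∨ u = j then (if {o} ⊆ s then (1 : ℝ) else 0) else 1)
    have e : (fun S : V → Finset O => ∏ u, if u = i ∨ u = j then
        (if {o} ⊆ S u then (1 : ℝ) else 0) else 1) =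
        fun S => if o ∈ S i ∩ S j then (1 : ℝ) else 0 := by
      funext S
      rw [Finset.prod_ite, Finset.prod_const_one, mul_one,
        show (Finset.univ.filter fun u => u = i ∨ u = j) = {i, j} by ext; simp,
        Finset.prod_pair hij]
      by_cases h1 : o ∈ S i <;> by_cases h2 : o ∈ S j <;> simp [h1, h2]
    rw [e] at h
    rw [h]
    have e2 : ∀ u, bernExp p (fun s : Finset O => if u = i ∨ u = j then
        (if {o} ⊆ s then (1 : ℝ) else 0) else 1) = if u = i ∨ u = j then p else 1 := by
      intro u
      split_ifs
      · rw [bernExp_subset]; simp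
      · rw [bernExp_one]
    simp_rw [e2]
    rw [Finset.prod_ite, Finset.prod_const_one, mul_one,
        show (Finset.univ.filter fun u => u = i ∨ u = j) = {i, j} by ext; simp,
        Finset.prod_pair hij, sq]
  have e : (fun S : V → Finset O => ((S i ∩ S j).card : ℝ)) =
      fun S => ∑ o, if o ∈ S i ∩ S j then (1 : ℝ) else 0 := by
    funext S
    rw [Finset.sum_boole]
    congr 2
    ext; simp
  rw [e, familyExp_sum]
  simp_rw [key]
  simp

/-- The sets of holders of the objects, in a family of object sets. -/
def holdersEquiv : (V → Finset O) ≃ (O → Finset V) where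
  toFun S o := Finset.univ.filter fun v => o ∈ S v
  invFun C v := Finset.univ.filter fun o => v ∈ C o
  left_inv S := by ext; simp
  right_inv C := by ext; simp

/-- The node–object incidence matrix has independent entries of the same law, so transposing it
preserves expectations. -/
theorem familyExp_holders (p : ℝ) (F : (O → Finset V) → ℝ) :
    familyExp p (fun S : V → Finset O => F (holdersEquiv S)) = familyExp p F := by
  unfold familyExp
  refine Fintype.sum_equiv holdersEquiv _ _ fun S => ?_
  congr 1
  simp only [bernWeight]
  rw [Finset.prod_comm]
  simp [holdersEquiv]

/-- Removing the object sets of the nodes in `T`. -/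
def eraseOn (T : Finset V) (S : V → Finset O) : V → Finset O :=
  fun v => if v ∈ T then ∅ else S v

/-- Conditionally on the object sets outside `T`, the object sets of the nodes in `T` are
independent. -/
theorem familyExp_cond_le {p q : ℝ} (h0 : 0 ≤ p) (h1 : p ≤ 1) (T : Finset V)
    (g : (V → Finset O) → Finset O → ℝ) (hg : ∀ S s, 0 ≤ g S s)
    (hgq : ∀ S, bernExp p (g (eraseOn T S)) ≤ q) :
    familyExp p (fun S => ∏ v ∈ T, g (eraseOn T S) (S v)) ≤ q ^ T.card := by
  let E := Equiv.piEquivPiSubtypeProd (fun v => v ∈ T) (fun _ : V => Finset O)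
  have hE : familyExp p (fun S => ∏ v ∈ T, g (eraseOn T S) (S v)) =
      ∑ c : {v // v ∉ T} → Finset O, (∏ v, bernWeight p (c v)) *
        familyExp p (fun a : {v // v ∈ T} → Finset O =>
          ∏ v, g (eraseOn T (E.symm (fun _ => ∅, c))) (a v)) := by
    unfold familyExp
    simp_rw [Finset.mul_sum]
    rw [Finset.sum_comm, ← Fintype.sum_prod_type']
    refine Fintype.sum_equiv E _ _ fun S => ?_
    have e1 : ∏ v, bernWeight p (S v) =
        (∏ v : {v // v ∈ T}, bernWeight p ((E S).1 v)) *
          ∏ v : {v // v ∉ T}, bernWeight p ((E S).2 v) := by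
      rw [← Fintype.prod_subtype_mul_prod_subtype (fun v => v ∈ T) (fun v => bernWeight p (S v))]
      congr!
    -- The filler `∅` on `T` is immaterial, since `eraseOn` resets these coordinates anyway.
    have e2 : eraseOn T (E.symm (fun _ => ∅, (E S).2)) = eraseOn T S := by
      funext v
      by_cases hv : v ∈ T <;> simp [eraseOn, E, hv]
    have e3 : ∏ v ∈ T, g (eraseOn T S) (S v) =
        ∏ v : {v // v ∈ T}, g (eraseOn T S) ((E S).1 v) :=
      (Finset.prod_coe_sort T fun v => g (eraseOn T S) (S v)).symm
    rw [e1, e2, e3]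
    ring
  rw [hE]
  calc _ ≤ ∑ c : {v // v ∉ T} → Finset O, (∏ v, bernWeight p (c v)) * q ^ T.card := by
        refine Finset.sum_le_sum fun c _ => mul_le_mul_of_nonneg_left ?_
          (Finset.prod_nonneg fun v _ => bernWeight_nonneg h0 h1 _)
        rw [familyExp_prod]
        calc _ ≤ ∏ v : {v // v ∈ T}, q := Finset.prod_le_prod
              (fun v _ => bernExp_nonneg h0 h1 (hg _)) (fun v _ => hgq _)
          _ = q ^ T.card := by simp
    _ = familyExp p (fun _ : {v // v ∉ T} → Finset O => q ^ T.card) := rfl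
    _ = _ := familyExp_const _ _

end BernoulliSets

open Classical in
/-- The probability of robustness is a finite weighted sum over families of finite sets. -/
theorem probBinomialRIGRobust_eq (k n P : ℕ) (p : unitInterval) :
    probBinomialRIGRobust k n P p = familyExp (p : ℝ) (fun S : Fin n → Finset (Fin P) =>
      if IsKRobust k (objectIntersectionGraph fun i => (S i : Set (Fin P))) then 1 else 0) := by
  unfold probBinomialRIGRobust familyExp binomialObjectSets
  set μ := Measure.pi fun _ : Fin n => ProbabilityTheory.setBernoulli (Set.univ : Set (Fin P)) p
  set A : Set (Fin n → Set (Fin P)) := {S | IsKRobust k (objectIntersectionGraph S)}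
  have hA : μ.real A = ∑ S ∈ Finset.univ.filter (· ∈ A), μ.real {S} := by
    rw [sum_measureReal_singleton]
    congr 1
    ext; simp
  have hs : ∀ S : Fin n → Finset (Fin P),
      μ.real {fun i => (S i : Set (Fin P))} = ∏ v, bernWeight (p : ℝ) (S v) := by
    intro S
    rw [measureReal_def, Measure.pi_singleton, ENNReal.toReal_prod]
    refine Finset.prod_congr rfl fun i _ => ?_
    rw [← measureReal_def, ProbabilityTheory.setBernoulli_real_singleton p (Set.subset_univ _)
      Set.finite_univ, bernWeight, Finset.prod_ite, Finset.prod_const, Finset.prod_const,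
      Set.ncard_coe_finset]
    congr 2
    · simp
    · rw [← Finset.coe_univ, ← Finset.coe_sdiff, Set.ncard_coe_finset]
      congr 1
      ext; simp
  rw [hA, Finset.sum_filter]
  symm
  refine Fintype.sum_equiv (Equiv.piCongrRight fun _ => Fintype.finsetEquivSet) _ _ fun S => ?_
  have : (Equiv.piCongrRight fun _ => Fintype.finsetEquivSet) S =
      fun i => (S i : Set (Fin P)) := by
    funext i; simp
  rw [this, hs]
  simp [A]

/-! ### One law: private objects, exponential moments and the union bound before asymptotics. -/

section Robustness

variable {V O : Type*} [Fintype V] [DecidableEq V] [DecidableEq O]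

/-- The objects of node `j` that no other node holds. -/
def privateObjects (S : V → Finset O) (j : V) : Finset O :=
  S j \ (Finset.univ.erase j).biUnion S

theorem privateObjects_subset (S : V → Finset O) (j : V) : privateObjects S j ⊆ S j :=
  Finset.sdiff_subset

theorem disjoint_privateObjects (S : V → Finset O) {i j : V} (hij : i ≠ j) :
    Disjoint (privateObjects S i) (privateObjects S j) := by
  rw [Finset.disjoint_left]
  intro o hi hj
  refine (Finset.mem_sdiff.1 hi).2 (Finset.mem_biUnion.2 ⟨j, ?_, (Finset.mem_sdiff.1 hj).1⟩)
  simp [hij.symm]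

theorem card_le_card_privateObjects_add (S : V → Finset O) (j : V) :
    (S j).card ≤ (privateObjects S j).card + ∑ i ∈ Finset.univ.erase j, (S i ∩ S j).card := by
  have h : S j ⊆ privateObjects S j ∪ (Finset.univ.erase j).biUnion fun i => S i ∩ S j := by
    intro o ho
    by_cases h : o ∈ (Finset.univ.erase j).biUnion S
    · obtain ⟨i, hi, hoi⟩ := Finset.mem_biUnion.1 h
      exact Finset.mem_union_right _ (Finset.mem_biUnion.2 ⟨i, hi, Finset.mem_inter.2 ⟨hoi, ho⟩⟩)
    · exact Finset.mem_union_left _ (Finset.mem_sdiff.2 ⟨ho, h⟩)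
  calc _ ≤ _ := Finset.card_le_card h
    _ ≤ _ := Finset.card_union_le _ _
    _ ≤ _ := by gcongr; exact Finset.card_biUnion_le

/-- Every private set that `S v` hits belongs to a different neighbor of `v` outside `T`, so at most
`k - 1` factors equal `z`. Private objects are taken after erasing `T`, which keeps them independent
of the sets inside `T`. -/
theorem pow_le_prod_privateObjects {k : ℕ} (hk : 1 ≤ k) {z : ℝ} (hz0 : 0 ≤ z) (hz1 : z ≤ 1)
    (S : V → Finset O) (T : Finset V) {v : V} (hv : v ∈ T)
    (h : ((objectIntersectionGraph fun i => (S i : Set O)).neighborSet v ∩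
      ((T : Set V)ᶜ)).encard < k) :
    z ^ (k - 1) ≤
      ∏ j ∈ Tᶜ, if Disjoint (S v) (privateObjects (eraseOn T S) j) then 1 else z := by
  rw [Finset.prod_ite, Finset.prod_const_one, one_mul, Finset.prod_const]
  refine pow_le_pow_of_le_one hz0 hz1 ?_
  have hsub : ((Tᶜ.filter fun j => ¬ Disjoint (S v) (privateObjects (eraseOn T S) j) :
      Finset V) : Set V) ⊆ (objectIntersectionGraph fun i => (S i : Set O)).neighborSet v ∩
        ((T : Set V)ᶜ) := by
    intro j hj
    simp only [Finset.coe_filter, Finset.mem_compl, Set.mem_ofPred_eq] at hj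
    refine ⟨⟨fun e => hj.1 (e ▸ hv), ?_⟩, by simpa using hj.1⟩
    obtain ⟨o, ho, ho'⟩ := Finset.not_disjoint_iff.1 hj.2
    refine ⟨o, by simpa using ho, ?_⟩
    have := privateObjects_subset _ _ ho'
    simpa [eraseOn, hj.1] using this
  have := (Set.encard_le_encard hsub).trans_lt h
  rw [Set.encard_coe_eq_coe_finsetCard] at this
  have : (Tᶜ.filter fun j => ¬ Disjoint (S v) (privateObjects (eraseOn T S) j)).card < k := by
    exact_mod_cast this
  omega

variable [Fintype O]

/-- Writing each factor as `z + (1 - z) · 1[disjoint]` and expanding leaves probabilities of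
avoiding unions of the `W j`; disjointness turns these into products. -/
theorem bernExp_prod_disjoint {ι : Type*} [DecidableEq ι] (p z : ℝ) (D : Finset ι)
    (W : ι → Finset O) (hW : (D : Set ι).PairwiseDisjoint W) :
    bernExp p (fun s => ∏ j ∈ D, if Disjoint s (W j) then 1 else z) =
      ∏ j ∈ D, (z + (1 - z) * (1 - p) ^ (W j).card) := by
  have e : (fun s : Finset O => ∏ j ∈ D, if Disjoint s (W j) then 1 else z) =
      fun s => ∑ A ∈ D.powerset, (z ^ A.card * (1 - z) ^ (D \ A).card) *
        (if Disjoint s ((D \ A).biUnion W) then 1 else 0) := by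
    funext s
    have : ∀ j ∈ D, (if Disjoint s (W j) then (1 : ℝ) else z) =
        z + (1 - z) * if Disjoint s (W j) then 1 else 0 := by
      intro j _; split_ifs <;> ring
    rw [Finset.prod_congr rfl this, Finset.prod_add]
    refine Finset.sum_congr rfl fun A _ => ?_
    rw [Finset.prod_const, Finset.prod_mul_distrib, Finset.prod_const, ← mul_assoc]
    congr 1
    rw [Finset.prod_ite_zero]
    simp [Finset.disjoint_biUnion_right]
  rw [e, bernExp_sum, Finset.prod_add]
  refine Finset.sum_congr rfl fun A hA => ?_
  rw [bernExp_const_mul, bernExp_disjoint, Finset.card_biUnion, Finset.prod_const,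
    Finset.prod_mul_distrib, Finset.prod_const, Finset.prod_pow_eq_pow_sum, mul_assoc]
  intro i hi j hj hij
  exact hW (Finset.mem_sdiff.1 hi).1 (Finset.mem_sdiff.1 hj).1 hij

theorem one_sub_pow_le_quadratic {p : ℝ} (h0 : 0 ≤ p) (h1 : p ≤ 1) (w : ℕ) :
    (1 - p) ^ w ≤ 1 - p * w + (p * w) ^ 2 / 2 := by
  induction w with
  | zero => simp
  | succ w ih =>
    have hw : (0 : ℝ) ≤ w := Nat.cast_nonneg w
    have : (1 - p) ^ (w + 1) ≤ (1 - p * w + (p * w) ^ 2 / 2) * (1 - p) := by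
      rw [pow_succ]; exact mul_le_mul_of_nonneg_right ih (by linarith)
    push_cast
    have h3 : 0 ≤ p * (p * w) ^ 2 := by positivity
    nlinarith [sq_nonneg p]

theorem prod_add_one_sub_pow_le_exp {ι : Type*} {p z : ℝ} (h0 : 0 ≤ p) (h1 : p ≤ 1) (hz0 : 0 ≤ z)
    (hz1 : z ≤ 1) (D : Finset ι) (w : ι → ℕ) :
    ∏ j ∈ D, (z + (1 - z) * (1 - p) ^ w j) ≤
      Real.exp (-((1 - z) * ∑ j ∈ D, (p * w j - (p * w j) ^ 2 / 2))) := by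
  rw [Finset.mul_sum, ← Finset.sum_neg_distrib, Real.exp_sum]
  refine Finset.prod_le_prod (fun j _ => ?_) fun j _ => ?_
  · have : 0 ≤ (1 - p) ^ w j := pow_nonneg (by linarith) _
    have : 0 ≤ (1 - z) * (1 - p) ^ w j := mul_nonneg (by linarith) this
    linarith
  · refine le_trans ?_ (Real.one_sub_le_exp_neg _)
    have := mul_le_mul_of_nonneg_left (one_sub_pow_le_quadratic h0 h1 (w j))
      (by linarith : 0 ≤ 1 - z)
    linarith

/-- A bound for the deviation of the sizes of the sets of private objects of the nodes in `D` from
their typical value; `t` is the scale at which deviations of set sizes are measured. -/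
noncomputable def fluctuation (p t : ℝ) (D : Finset V) (S : V → Finset O) : ℝ :=
  ∑ j ∈ D, (p * ((((S j).card : ℝ) - Fintype.card O * p) ^ 2 / (2 * t) + t / 2 +
      ∑ i ∈ Finset.univ.erase j, ((S i ∩ S j).card : ℝ)) +
    p ^ 2 * ((Fintype.card O * p) ^ 2 + (((S j).card : ℝ) - Fintype.card O * p) ^ 2))

theorem fluctuation_nonneg {p t : ℝ} (h0 : 0 ≤ p) (ht : 0 < t) (D : Finset V)
    (S : V → Finset O) : 0 ≤ fluctuation p t D S := by
  unfold fluctuation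
  refine Finset.sum_nonneg fun j _ => ?_
  positivity

/-- All summands are nonnegative and intersections only shrink under erasing. Hence one event, not
depending on `T`, controls the private sets for all `T` simultaneously, and its probability is paid
only once. -/
theorem fluctuation_eraseOn_le {p t : ℝ} (h0 : 0 ≤ p) (ht : 0 < t) (T : Finset V)
    (S : V → Finset O) : fluctuation p t Tᶜ (eraseOn T S) ≤ fluctuation p t Finset.univ S := by
  unfold fluctuation
  calc _ ≤ ∑ j ∈ Tᶜ, (p * ((((S j).card : ℝ) - Fintype.card O * p) ^ 2 / (2 * t) + t / 2 +
      ∑ i ∈ Finset.univ.erase j, ((S i ∩ S j).card : ℝ)) +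
    p ^ 2 * ((Fintype.card O * p) ^ 2 + (((S j).card : ℝ) - Fintype.card O * p) ^ 2)) := by
        refine Finset.sum_le_sum fun j hj => ?_
        have hj' : eraseOn T S j = S j := by
          have : j ∉ T := by simpa using hj
          simp [eraseOn, this]
        rw [hj']
        gcongr with i _
        unfold eraseOn
        split_ifs <;> simp
    _ ≤ _ := by
        refine Finset.sum_le_sum_of_subset_of_nonneg (Finset.subset_univ _) fun j _ _ => ?_
        positivity

/-- A private set loses at most the deviation of `|S j|` from its mean and the overlaps with the
other sets; the quadratic correction is absorbed by the `p ^ 2` terms of `fluctuation`. -/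
theorem le_sum_privateObjects {p t : ℝ} (h0 : 0 ≤ p) (ht : 0 < t) (D : Finset V)
    (S : V → Finset O) :
    D.card * (p * (Fintype.card O * p)) - fluctuation p t D S ≤
      ∑ j ∈ D, (p * (privateObjects S j).card - (p * (privateObjects S j).card) ^ 2 / 2) := by
  rw [fluctuation, ← nsmul_eq_mul, ← Finset.sum_const, ← Finset.sum_sub_distrib]
  refine Finset.sum_le_sum fun j _ => ?_
  set μ : ℝ := Fintype.card O * p
  have h1 : ((S j).card : ℝ) ≤ (privateObjects S j).card +
      ∑ i ∈ Finset.univ.erase j, ((S i ∩ S j).card : ℝ) := by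
    exact_mod_cast card_le_card_privateObjects_add S j
  have h2 : ((privateObjects S j).card : ℝ) ≤ (S j).card := by
    exact_mod_cast Finset.card_le_card (privateObjects_subset S j)
  set w : ℝ := ((privateObjects S j).card : ℝ)
  have hw : 0 ≤ w := Nat.cast_nonneg _
  set R := ∑ i ∈ Finset.univ.erase j, ((S i ∩ S j).card : ℝ)
  set x : ℝ := ((S j).card : ℝ)
  -- Weighted arithmetic–geometric mean inequality: it replaces a first absolute moment by a
  -- variance.
  have h3 : μ - x ≤ (x - μ) ^ 2 / (2 * t) + t / 2 := by
    rw [div_add_div _ _ (by positivity) (by norm_num), le_div_iff₀ (by positivity)]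
    nlinarith [sq_nonneg (x - μ + t)]
  have h4 : w ^ 2 / 2 ≤ μ ^ 2 + (x - μ) ^ 2 := by
    have : w ^ 2 ≤ x ^ 2 := by gcongr
    nlinarith [sq_nonneg (x - 2 * μ)]
  have h5 := mul_le_mul_of_nonneg_left h4 (sq_nonneg p)
  have h6 := mul_le_mul_of_nonneg_left (show μ - ((x - μ) ^ 2 / (2 * t) + t / 2 + R) ≤ w by
    linarith) h0
  nlinarith

theorem familyExp_fluctuation_le {p t : ℝ} (h0 : 0 ≤ p) (ht : 0 < t) :
    familyExp p (fun S : V → Finset O => fluctuation p t Finset.univ S) ≤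
      Fintype.card V * (p * (Fintype.card O * p / (2 * t) + t / 2 +
        Fintype.card V * (Fintype.card O * p ^ 2)) +
        p ^ 2 * ((Fintype.card O * p) ^ 2 + Fintype.card O * p)) := by
  unfold fluctuation
  rw [familyExp_sum]
  refine (Finset.sum_le_card_nsmul Finset.univ _ _ fun j _ => ?_).trans_eq (nsmul_eq_mul _ _)
  set μ : ℝ := Fintype.card O * p
  have hd : familyExp p (fun S : V → Finset O => (((S j).card : ℝ) - μ) ^ 2) ≤ μ := by
    rw [familyExp_comp_apply p j fun s => ((s.card : ℝ) - μ) ^ 2]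
    exact bernExp_card_sub_sq_le p
  have e : (fun S : V → Finset O => p * ((((S j).card : ℝ) - μ) ^ 2 / (2 * t) + t / 2 +
      ∑ i ∈ Finset.univ.erase j, ((S i ∩ S j).card : ℝ)) +
      p ^ 2 * (μ ^ 2 + (((S j).card : ℝ) - μ) ^ 2)) =
      fun S => (p / (2 * t) + p ^ 2) * (((S j).card : ℝ) - μ) ^ 2 +
        ((p * (t / 2) + p ^ 2 * μ ^ 2) +
          p * ∑ i ∈ Finset.univ.erase j, ((S i ∩ S j).card : ℝ)) := by
    funext S; field_simp; ring
  rw [e, familyExp_add, familyExp_add, familyExp_const_mul, familyExp_const_mul,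
    familyExp_const, familyExp_sum]
  have hR : ∑ i ∈ Finset.univ.erase j, familyExp p
      (fun S : V → Finset O => ((S i ∩ S j).card : ℝ)) ≤
        Fintype.card V * (Fintype.card O * p ^ 2) := by
    calc _ = ∑ i ∈ Finset.univ.erase j, (Fintype.card O * p ^ 2) :=
          Finset.sum_congr rfl fun i hi => familyExp_card_inter p (Finset.ne_of_mem_erase hi)
      _ ≤ ∑ i : V, (Fintype.card O * p ^ 2) :=
          Finset.sum_le_sum_of_subset_of_nonneg (Finset.erase_subset _ _) fun _ _ _ => by
            positivity
      _ = _ := by simp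
  have a1 := mul_le_mul_of_nonneg_left hd (show 0 ≤ p / (2 * t) + p ^ 2 by positivity)
  have a2 := mul_le_mul_of_nonneg_left hR h0
  have a3 : (p / (2 * t) + p ^ 2) * μ = p * (μ / (2 * t)) + p ^ 2 * μ := by ring
  nlinarith

/-- If `G` is not `k`-robust, then some set of at most half of the nodes consists of nodes that have
fewer than `k` neighbors outside of it. -/
theorem exists_finset_of_not_isKRobust {k : ℕ} {G : SimpleGraph V} (h : ¬ IsKRobust k G) :
    ∃ T : Finset V, T.Nonempty ∧ 2 * T.card ≤ Fintype.card V ∧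
      ∀ v ∈ T, (G.neighborSet v ∩ ((T : Set V)ᶜ)).encard < k := by
  classical
  unfold IsKRobust at h
  push Not at h
  obtain ⟨T, hT, hT', ha, hb⟩ := h
  have hcard := Finset.card_add_card_compl T.toFinset
  -- The failures of (a) and (b) are exchanged by complementation, so the smaller side can be
  -- chosen.
  rcases le_total T.toFinset.card (T.toFinsetᶜ).card with hle | hle
  · refine ⟨T.toFinset, by simpa using hT, by omega, fun v hv => ?_⟩
    rw [Set.coe_toFinset]
    exact ha v (by simpa using hv)
  · refine ⟨T.toFinsetᶜ, ?_, by omega, fun v hv => ?_⟩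
    · rw [← Set.toFinset_compl]
      rwa [Set.toFinset_nonempty, Set.nonempty_compl]
    · rw [Finset.coe_compl, Set.coe_toFinset, compl_compl]
      exact hb v (by simpa using hv)

/-- The indicator of failure is at most `fluctuation` (when that exceeds `1`) plus the sum over the
possible obstructing sets `T`. The first part is Markov's inequality, the second the union bound. -/
theorem familyExp_not_isKRobust_le {k : ℕ} (hk : 1 ≤ k) {p z t : ℝ} (h0 : 0 ≤ p) (h1 : p ≤ 1)
    (hz0 : 0 < z) (hz1 : z ≤ 1) (ht : 0 < t) :
    familyExp p (Set.indicator {S : V → Finset O |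
        ¬ IsKRobust k (objectIntersectionGraph fun i => (S i : Set O))} 1) ≤
      Fintype.card V * (p * (Fintype.card O * p / (2 * t) + t / 2 +
        Fintype.card V * (Fintype.card O * p ^ 2)) +
        p ^ 2 * ((Fintype.card O * p) ^ 2 + Fintype.card O * p)) +
      ∑ T : Finset V with T.Nonempty ∧ 2 * T.card ≤ Fintype.card V,
        ((z⁻¹) ^ (k - 1) * Real.exp (-((1 - z) *
          ((Tᶜ.card : ℝ) * (p * (Fintype.card O * p)) - 1)))) ^ T.card := by
  -- The cutoff is built into `g` and evaluated on the sets outside `T`, so the conditional bound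
  -- holds for every outcome of those sets.
  obtain ⟨g, hgdef⟩ : ∃ g : Finset V → (V → Finset O) → Finset O → ℝ, ∀ T S, g T S = fun s =>
      if fluctuation p t Tᶜ S ≤ 1 then
        (z⁻¹) ^ (k - 1) * ∏ j ∈ Tᶜ, (if Disjoint s (privateObjects S j) then 1 else z) else 0 :=
    ⟨_, fun _ _ => rfl⟩
  have hg : ∀ T S s, 0 ≤ g T S s := by
    intro T S s
    simp only [hgdef]
    split_ifs
    · exact mul_nonneg (by positivity) (Finset.prod_nonneg fun j _ => by split_ifs <;> linarith)
    · exact le_rfl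
  have hfl : ∀ S : V → Finset O, 0 ≤ fluctuation p t Finset.univ S :=
    fluctuation_nonneg h0 ht _
  have hpt : ∀ S : V → Finset O,
      Set.indicator {S : V → Finset O |
        ¬ IsKRobust k (objectIntersectionGraph fun i => (S i : Set O))} (1 : (V → Finset O) → ℝ) S ≤
        fluctuation p t Finset.univ S +
          ∑ T : Finset V with T.Nonempty ∧ 2 * T.card ≤ Fintype.card V,
            ∏ v ∈ T, g T (eraseOn T S) (S v) := by
    intro S
    have hnn : 0 ≤ ∑ T : Finset V with T.Nonempty ∧ 2 * T.card ≤ Fintype.card V,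
            ∏ v ∈ T, g T (eraseOn T S) (S v) :=
      Finset.sum_nonneg fun T _ => Finset.prod_nonneg fun v _ => hg _ _ _
    by_cases hr : IsKRobust k (objectIntersectionGraph fun i => (S i : Set O))
    · rw [Set.indicator_of_notMem (by simpa using hr)]
      exact add_nonneg (hfl S) hnn
    · rw [Set.indicator_of_mem (by simpa using hr), Pi.one_apply]
      by_cases hE : fluctuation p t Finset.univ S ≤ 1
      · obtain ⟨T, hT, hT2, hT3⟩ := exists_finset_of_not_isKRobust hr
        have : 1 ≤ ∏ v ∈ T, g T (eraseOn T S) (S v) := by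
          rw [← Finset.prod_const_one (s := T)]
          refine Finset.prod_le_prod (fun _ _ => zero_le_one) fun v hv => ?_
          simp only [hgdef]
          rw [if_pos ((fluctuation_eraseOn_le h0 ht T S).trans hE)]
          have := pow_le_prod_privateObjects hk hz0.le hz1 S T hv (hT3 v hv)
          calc (1 : ℝ) = (z⁻¹) ^ (k - 1) * z ^ (k - 1) := by
                rw [← mul_pow, inv_mul_cancel₀ hz0.ne', one_pow]
            _ ≤ _ := mul_le_mul_of_nonneg_left this (by positivity)
        have h2 : ∏ v ∈ T, g T (eraseOn T S) (S v) ≤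
            ∑ T : Finset V with T.Nonempty ∧ 2 * T.card ≤ Fintype.card V,
              ∏ v ∈ T, g T (eraseOn T S) (S v) := Finset.single_le_sum
          (f := fun T => ∏ v ∈ T, g T (eraseOn T S) (S v))
          (fun T _ => Finset.prod_nonneg fun v _ => hg T (eraseOn T S) (S v))
          (Finset.mem_filter.2 ⟨Finset.mem_univ T, hT, hT2⟩)
        have := hfl S
        linarith
      · linarith
  refine (familyExp_mono h0 h1 hpt).trans ?_
  rw [familyExp_add, familyExp_sum]
  refine add_le_add (familyExp_fluctuation_le h0 ht) (Finset.sum_le_sum fun T _ => ?_)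
  refine familyExp_cond_le h0 h1 T (g T) (hg T) fun S => ?_
  rw [hgdef]
  split_ifs with hE
  · rw [bernExp_const_mul, bernExp_prod_disjoint _ _ _ _
      fun i _ j _ hij => disjoint_privateObjects _ hij]
    gcongr
    refine (prod_add_one_sub_pow_le_exp h0 h1 hz0.le hz1 _ _).trans ?_
    rw [Real.exp_le_exp, neg_le_neg_iff]
    refine mul_le_mul_of_nonneg_left ?_ (by linarith)
    have := le_sum_privateObjects h0 ht Tᶜ (eraseOn T S)
    linarith
  · rw [bernExp_const]
    positivity

end Robustness

/-! ### Sums over subsets of fixed size, weighted by an intersection. -/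

section SubsetSums

variable {O : Type*} [Fintype O] [DecidableEq O]

/-- The ratio of the two binomial coefficients is the product of `(r - i) / (N - i)` over `i < b`,
and each factor is at most `r / N`. -/
theorem pow_mul_choose_sub_le (N r b : ℕ) (hb : b ≤ r) (hr : r ≤ N) :
    N ^ b * (N - b).choose (r - b) ≤ r ^ b * N.choose r := by
  induction b with
  | zero => simp
  | succ b ih =>
    have ih := ih (by omega)
    obtain ⟨m, hm⟩ : ∃ m, N - b = m + 1 := ⟨N - b - 1, by omega⟩
    obtain ⟨s, hs⟩ : ∃ s, r - b = s + 1 := ⟨r - b - 1, by omega⟩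
    have h1 := Nat.add_one_mul_choose_eq m s
    rw [hm, hs] at ih
    rw [show N - (b + 1) = m by omega, show r - (b + 1) = s by omega]
    have h2 : N * (s + 1) ≤ r * (m + 1) := by
      have e1 : N = m + 1 + b := by omega
      have e2 : r = s + 1 + b := by omega
      have : s ≤ m := by omega
      rw [e1, e2]
      nlinarith
    refine Nat.le_of_mul_le_mul_right (c := m + 1) ?_ (by omega)
    calc N ^ (b + 1) * m.choose s * (m + 1) = N ^ b * N * ((m + 1) * m.choose s) := by ring
      _ = (N * (s + 1)) * (N ^ b * (m + 1).choose (s + 1)) := by rw [h1]; ring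
      _ ≤ (r * (m + 1)) * (r ^ b * N.choose r) := Nat.mul_le_mul h2 ih
      _ = _ := by ring

/-- Bound `x ^ |I ∩ J|` by the sum of `x ^ |B|` over `B ⊆ I ∩ J`, count the `J` containing each `B`,
and resum by the binomial theorem. -/
theorem sum_pow_card_inter_le {x : ℝ} (hx : 0 ≤ x) (r : ℕ) (hr : r ≤ Fintype.card O)
    (hO : 0 < Fintype.card O) (I : Finset O) (hI : I.card = r) :
    ∑ J ∈ Finset.powersetCard r Finset.univ, x ^ (I ∩ J).card ≤
      (Fintype.card O).choose r * (1 + x * (r / Fintype.card O)) ^ r := by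
  have h1 : ∀ J : Finset O, x ^ (I ∩ J).card ≤
      ∑ B ∈ I.powerset, if B ⊆ J then x ^ B.card else 0 := by
    intro J
    rw [← Finset.sum_filter]
    have : I.powerset.filter (· ⊆ J) = (I ∩ J).powerset := by
      ext B; rw [Finset.mem_filter, Finset.mem_powerset, Finset.mem_powerset, Finset.subset_inter_iff]
    rw [this]
    exact Finset.single_le_sum (f := fun B : Finset O => x ^ B.card) (fun B _ => by positivity)
      (Finset.mem_powerset_self (I ∩ J))
  have hP : (0 : ℝ) < Fintype.card O := by exact_mod_cast hO
  calc _ ≤ ∑ J ∈ Finset.powersetCard r (Finset.univ : Finset O),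
        ∑ B ∈ I.powerset, if B ⊆ J then x ^ B.card else 0 := Finset.sum_le_sum fun J _ => h1 J
    _ = ∑ B ∈ I.powerset, x ^ B.card *
        ((Fintype.card O - B.card).choose (r - B.card) : ℕ) := by
      rw [Finset.sum_comm]
      refine Finset.sum_congr rfl fun B hB => ?_
      rw [← Finset.sum_filter, Finset.sum_const, Finset.card_filter_powersetCard_subset B _ r
        (Finset.subset_univ B) (hI ▸ Finset.card_le_card (Finset.mem_powerset.1 hB)),
        Finset.card_univ, nsmul_eq_mul, mul_comm]
    _ ≤ ∑ B ∈ I.powerset, (Fintype.card O).choose r *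
        ((x * (r / Fintype.card O)) ^ B.card * 1 ^ (I.card - B.card)) := by
      refine Finset.sum_le_sum fun B hB => ?_
      have hb : B.card ≤ r := hI ▸ Finset.card_le_card (Finset.mem_powerset.1 hB)
      have h : (Fintype.card O : ℝ) ^ B.card *
          ((Fintype.card O - B.card).choose (r - B.card) : ℕ) ≤
            (r : ℝ) ^ B.card * (Fintype.card O).choose r := by
        exact_mod_cast pow_mul_choose_sub_le _ r B.card hb hr
      rw [one_pow, mul_one, mul_pow, div_pow, mul_left_comm]
      refine mul_le_mul_of_nonneg_left ?_ (by positivity)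
      rw [mul_div_assoc', le_div_iff₀ (by positivity)]
      linarith
    _ = _ := by
      rw [← Finset.mul_sum, Finset.sum_pow_mul_eq_add_pow, hI, add_comm]

end SubsetSums

/-! ### Zero law: indicators of nodes with a prescribed set of shared objects. -/

section ShareIndicator

variable {V O : Type*} [DecidableEq V] [DecidableEq O]

/-- The indicator of the event that the object `o` with set of holders `H` is held by `v` and
exactly one other node if `o ∈ I`, and is not shared by `v` with other nodes if `o ∉ I`. -/
noncomputable def shareFactor (v : V) (I : Finset O) (o : O) (H : Finset V) : ℝ :=
  if o ∈ I then (if v ∈ H ∧ H.card = 2 then 1 else 0)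
  else (if v ∈ H ∧ 2 ≤ H.card then 0 else 1)

theorem shareFactor_nonneg (v : V) (I : Finset O) (o : O) (H : Finset V) :
    0 ≤ shareFactor v I o H := by
  unfold shareFactor; split_ifs <;> norm_num

theorem shareFactor_le_one (v : V) (I : Finset O) (o : O) (H : Finset V) :
    shareFactor v I o H ≤ 1 := by
  unfold shareFactor; split_ifs <;> norm_num

variable [Fintype O]

/-- The indicator of the event that `v` shares precisely the objects in `I` with other nodes, and
each of them with one other node. -/
noncomputable def shareIndicator (v : V) (I : Finset O) (C : O → Finset V) : ℝ :=
  ∏ o, shareFactor v I o (C o)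

theorem shareIndicator_nonneg (v : V) (I : Finset O) (C : O → Finset V) :
    0 ≤ shareIndicator v I C :=
  Finset.prod_nonneg fun _ _ => shareFactor_nonneg _ _ _ _

theorem shareIndicator_le_one (v : V) (I : Finset O) (C : O → Finset V) :
    shareIndicator v I C ≤ 1 :=
  Finset.prod_le_one (fun _ _ => shareFactor_nonneg _ _ _ _)
    fun _ _ => shareFactor_le_one _ _ _ _

/-- An object of `I` outside `J` would have to be both shared and not shared by `v`. -/
theorem shareIndicator_mul_eq_zero (v : V) {I J : Finset O} (hIJ : I ≠ J)
    (hc : I.card = J.card) (C : O → Finset V) :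
    shareIndicator v I C * shareIndicator v J C = 0 := by
  obtain ⟨o, hI, hJ⟩ : ∃ o ∈ I, o ∉ J :=
    Finset.not_subset.1 fun h => hIJ (Finset.eq_of_subset_of_card_le h hc.ge)
  rw [shareIndicator, shareIndicator, ← Finset.prod_mul_distrib]
  refine Finset.prod_eq_zero (Finset.mem_univ o) ?_
  unfold shareFactor
  rw [if_pos hI, if_neg hJ]
  by_cases h1 : v ∈ C o <;> by_cases h2 : (C o).card = 2 <;> simp [h1, h2]

end ShareIndicator

/-! ### Zero law: moments of the number of low-degree nodes. -/

section SecondMoment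

variable {V O : Type*} [DecidableEq V] [Fintype V]

theorem bernExp_eq (p : ℝ) (A : Finset V) :
    bernExp p (fun H => if H = A then 1 else 0) =
      p ^ A.card * (1 - p) ^ (Fintype.card V - A.card) := by
  rw [← Finset.card_compl, ← bernExp_subset_disjoint p A Aᶜ disjoint_compl_right]
  congr 1
  funext H
  have : H = A ↔ A ⊆ H ∧ Disjoint H Aᶜ := by
    rw [disjoint_compl_right_iff, and_comm]
    exact Finset.Subset.antisymm_iff
  simp only [this]

/-- The probability that a given node and exactly one other node hold a given object. -/
noncomputable def pairProb (n : ℕ) (p : ℝ) : ℝ :=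
  ((n - 1 : ℕ) : ℝ) * (p ^ 2 * (1 - p) ^ (n - 2))

/-- The probability that a given node shares a given object with another node. -/
noncomputable def shareProb (n : ℕ) (p : ℝ) : ℝ :=
  p - p * (1 - p) ^ (n - 1)

theorem shareProb_le {p : ℝ} (h0 : 0 ≤ p) (h1 : p ≤ 1) (n : ℕ) : shareProb n p ≤ p := by
  have : 0 ≤ p * (1 - p) ^ (n - 1) := mul_nonneg h0 (pow_nonneg (by linarith) _)
  unfold shareProb
  linarith

theorem not_share_prob_nonneg {p : ℝ} (h0 : 0 ≤ p) (h1 : p ≤ 1) (n : ℕ) :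
    0 ≤ 1 - 2 * shareProb n p + p ^ 2 := by
  nlinarith [shareProb_le h0 h1 n, sq_nonneg (1 - p)]

theorem bernExp_pair (p : ℝ) (v : V) :
    bernExp p (fun H => if v ∈ H ∧ H.card = 2 then 1 else 0) = pairProb (Fintype.card V) p := by
  have e : (fun H : Finset V => if v ∈ H ∧ H.card = 2 then (1 : ℝ) else 0) =
      fun H => ∑ w ∈ Finset.univ.erase v, if H = {v, w} then 1 else 0 := by
    funext H
    split_ifs with h
    · obtain ⟨w, hw⟩ : ∃ w, H = {v, w} ∧ w ≠ v := by
        obtain ⟨a, b, hab, rfl⟩ := Finset.card_eq_two.1 h.2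
        rcases Finset.mem_insert.1 h.1 with rfl | h'
        · exact ⟨b, rfl, hab.symm⟩
        · rw [Finset.mem_singleton] at h'
          subst h'
          exact ⟨a, Finset.pair_comm _ _, hab⟩
      rw [Finset.sum_eq_single w]
      · simp [hw.1]
      · intro u hu huw
        rw [if_neg]
        rw [hw.1]
        intro he
        have : u ∈ ({v, w} : Finset V) := he ▸ by simp
        simp only [Finset.mem_insert, Finset.mem_singleton] at this
        exact this.elim (Finset.ne_of_mem_erase hu) huw
      · simp [hw.2]
    · symm
      refine Finset.sum_eq_zero fun w hw => if_neg ?_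
      rintro rfl
      exact h ⟨by simp, Finset.card_pair (Finset.ne_of_mem_erase hw).symm⟩
  rw [e, bernExp_sum, pairProb, ← Finset.card_univ, ← Finset.card_erase_of_mem (Finset.mem_univ v),
    ← nsmul_eq_mul, ← Finset.sum_const]
  refine Finset.sum_congr rfl fun w hw => ?_
  rw [bernExp_eq, Finset.card_pair (Finset.ne_of_mem_erase hw).symm, Finset.card_univ]

theorem bernExp_share (p : ℝ) (v : V) :
    bernExp p (fun H => if v ∈ H ∧ 2 ≤ H.card then 1 else 0) = shareProb (Fintype.card V) p := by
  have e : (fun H : Finset V => if v ∈ H ∧ 2 ≤ H.card then (1 : ℝ) else 0) =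
      fun H => (if {v} ⊆ H then 1 else 0) + (-1) * (if H = {v} then 1 else 0) := by
    funext H
    by_cases h : v ∈ H
    · by_cases h2 : H = {v}
      · simp [h2]
      · have : 2 ≤ H.card := by
          have h0 : 0 < H.card := Finset.card_pos.2 ⟨v, h⟩
          have h1 : H.card ≠ 1 := fun h1 => by
            obtain ⟨a, rfl⟩ := Finset.card_eq_one.1 h1
            simp at h
            exact h2 (by rw [h])
          omega
        simp [h, h2, this]
    · have : H ≠ {v} := by rintro rfl; simp at h
      simp [h, this]
  rw [e, bernExp_add, bernExp_const_mul, bernExp_subset, bernExp_eq, shareProb]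
  simp
  ring

theorem bernExp_not_share (p : ℝ) (v : V) :
    bernExp p (fun H => if v ∈ H ∧ 2 ≤ H.card then 0 else 1) =
      1 - shareProb (Fintype.card V) p := by
  have e : (fun H : Finset V => if v ∈ H ∧ 2 ≤ H.card then (0 : ℝ) else 1) =
      fun H => 1 + (-1) * if v ∈ H ∧ 2 ≤ H.card then 1 else 0 := by
    funext H; split_ifs <;> ring
  rw [e, bernExp_add, bernExp_const_mul, bernExp_share, bernExp_one]
  ring

/-- Inclusion–exclusion; when both nodes hold the object it is automatically shared, so the joint
term is just `p ^ 2`. -/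
theorem bernExp_not_share_mul (p : ℝ) {u v : V} (huv : v ≠ u) :
    bernExp p (fun H => (if v ∈ H ∧ 2 ≤ H.card then 0 else 1) *
      (if u ∈ H ∧ 2 ≤ H.card then 0 else 1)) =
      1 - 2 * shareProb (Fintype.card V) p + p ^ 2 := by
  have e : (fun H : Finset V => (if v ∈ H ∧ 2 ≤ H.card then (0 : ℝ) else 1) *
      (if u ∈ H ∧ 2 ≤ H.card then 0 else 1)) =
      fun H => 1 + ((-1) * (if v ∈ H ∧ 2 ≤ H.card then 1 else 0) +
        ((-1) * (if u ∈ H ∧ 2 ≤ H.card then 1 else 0) + if {v, u} ⊆ H then 1 else 0)) := by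
    funext H
    have : {v, u} ⊆ H ↔ (v ∈ H ∧ 2 ≤ H.card) ∧ (u ∈ H ∧ 2 ≤ H.card) := by
      constructor
      · intro h
        have h2 := Finset.card_le_card h
        rw [Finset.card_pair huv] at h2
        exact ⟨⟨h (by simp), h2⟩, h (by simp), h2⟩
      · rintro ⟨⟨h1, -⟩, h2, -⟩
        simp [Finset.insert_subset_iff, h1, h2]
    simp only [this]
    split_ifs <;> simp_all
  rw [e, bernExp_add, bernExp_add, bernExp_add, bernExp_const_mul, bernExp_const_mul,
    bernExp_share, bernExp_share, bernExp_one, bernExp_subset, Finset.card_pair huv]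
  ring

variable [DecidableEq O]

theorem bernExp_shareFactor (p : ℝ) (v : V) (I : Finset O) (o : O) :
    bernExp p (shareFactor v I o) =
      if o ∈ I then pairProb (Fintype.card V) p else 1 - shareProb (Fintype.card V) p := by
  unfold shareFactor
  split_ifs
  · exact bernExp_pair p v
  · exact bernExp_not_share p v

/-- Positive correlation arises mainly from `o ∈ I ∩ J`, where the bound is `p ^ 2` and not
`pairProb ^ 2`. -/
theorem bernExp_shareFactor_mul_le {p : ℝ} (h0 : 0 ≤ p) (h1 : p ≤ 1) {u v : V} (huv : v ≠ u)
    (I J : Finset O) (o : O) :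
    bernExp p (fun H => shareFactor v I o H * shareFactor u J o H) ≤
      if o ∈ I then (if o ∈ J then p ^ 2 else pairProb (Fintype.card V) p)
      else (if o ∈ J then pairProb (Fintype.card V) p
        else 1 - 2 * shareProb (Fintype.card V) p + p ^ 2) := by
  by_cases hI : o ∈ I
  · by_cases hJ : o ∈ J
    · rw [if_pos hI, if_pos hJ, ← Finset.card_pair huv, ← bernExp_subset]
      refine bernExp_mono h0 h1 fun H => ?_
      unfold shareFactor
      rw [if_pos hI, if_pos hJ]
      by_cases h1 : v ∈ H <;> by_cases h2 : u ∈ H <;> by_cases h3 : H.card = 2 <;>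
        simp [h1, h2, h3, Finset.insert_subset_iff]
    · rw [if_pos hI, if_neg hJ]
      have := bernExp_shareFactor p v I o
      rw [if_pos hI] at this
      rw [← this]
      exact bernExp_mono h0 h1 fun H =>
        mul_le_of_le_one_right (shareFactor_nonneg _ _ _ _) (shareFactor_le_one _ _ _ _)
  · by_cases hJ : o ∈ J
    · rw [if_neg hI, if_pos hJ]
      have := bernExp_shareFactor p u J o
      rw [if_pos hJ] at this
      rw [← this]
      exact bernExp_mono h0 h1 fun H =>
        mul_le_of_le_one_left (shareFactor_nonneg _ _ _ _) (shareFactor_le_one _ _ _ _)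
    · rw [if_neg hI, if_neg hJ, ← bernExp_not_share_mul p huv]
      simp [shareFactor, hI, hJ]

variable [Fintype O]

theorem familyExp_shareIndicator (p : ℝ) (v : V) (I : Finset O) :
    familyExp p (shareIndicator v I) = pairProb (Fintype.card V) p ^ I.card *
      (1 - shareProb (Fintype.card V) p) ^ (Fintype.card O - I.card) := by
  unfold shareIndicator
  rw [familyExp_prod p fun o => shareFactor v I o]
  simp_rw [bernExp_shareFactor]
  rw [Finset.prod_ite, Finset.prod_const, Finset.prod_const, ← Finset.card_compl]
  congr 3
  · ext; simp
  · ext; simp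

theorem familyExp_shareIndicator_mul_le {p : ℝ} (h0 : 0 ≤ p) (h1 : p ≤ 1)
    (hb : 0 < pairProb (Fintype.card V) p) {u v : V} (huv : v ≠ u) {r : ℕ}
    {I J : Finset O} (hI : I.card = r) (hJ : J.card = r) :
    familyExp p (fun C => shareIndicator v I C * shareIndicator u J C) ≤
      (p ^ 2 / pairProb (Fintype.card V) p ^ 2) ^ (I ∩ J).card *
        (pairProb (Fintype.card V) p ^ (2 * r) *
        (1 - 2 * shareProb (Fintype.card V) p + p ^ 2) ^ (Fintype.card O - 2 * r)) := by
  have hd := bernExp_not_share_mul p huv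
  have hd0 := not_share_prob_nonneg h0 h1 (Fintype.card V)
  have hd1 : 1 - 2 * shareProb (Fintype.card V) p + p ^ 2 ≤ 1 := by
    rw [← hd]
    refine (bernExp_mono h0 h1 (g := fun _ => 1) fun H => ?_).trans_eq (bernExp_one p)
    split_ifs <;> norm_num
  set b := pairProb (Fintype.card V) p
  set d := 1 - 2 * shareProb (Fintype.card V) p + p ^ 2
  have e : (fun C : O → Finset V => shareIndicator v I C * shareIndicator u J C) =
      fun C => ∏ o, (fun H => shareFactor v I o H * shareFactor u J o H) (C o) := by
    funext C
    rw [shareIndicator, shareIndicator, ← Finset.prod_mul_distrib]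
  rw [e, familyExp_prod p fun o => fun H => shareFactor v I o H * shareFactor u J o H]
  calc _ ≤ ∏ o, (if o ∈ I then (if o ∈ J then p ^ 2 else b) else (if o ∈ J then b else d)) :=
        Finset.prod_le_prod (fun o _ => bernExp_nonneg h0 h1 fun H =>
          mul_nonneg (shareFactor_nonneg _ _ _ _) (shareFactor_nonneg _ _ _ _))
          fun o _ => bernExp_shareFactor_mul_le h0 h1 huv I J o
    _ = ∏ o, ((if o ∈ I ∩ J then p ^ 2 / b ^ 2 else 1) * ((if o ∈ I then b else 1) *
          (if o ∈ J then b else 1)) * (if o ∈ (I ∪ J)ᶜ then d else 1)) := by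
        refine Finset.prod_congr rfl fun o _ => ?_
        by_cases h1 : o ∈ I <;> by_cases h2 : o ∈ J <;> simp [h1, h2]
        field_simp
    _ = (p ^ 2 / b ^ 2) ^ (I ∩ J).card * (b ^ (2 * r) * d ^ ((I ∪ J)ᶜ).card) := by
        simp_rw [Finset.prod_mul_distrib, Finset.prod_ite_mem, Finset.univ_inter,
          Finset.prod_const, hI, hJ]
        ring
    -- Since `|I ∪ J| ≤ 2 r` and the base lies in `[0, 1]`, the exponent may be lowered to one
    -- independent of `I` and `J`.
    _ ≤ _ := by
        have : Fintype.card O - 2 * r ≤ ((I ∪ J)ᶜ).card := by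
          rw [Finset.card_compl]
          have := Finset.card_union_le I J
          omega
        have := pow_le_pow_of_le_one hd0 hd1 this
        gcongr

/-- The number of nodes that share precisely `r` objects with other nodes, each of them with one
other node. -/
noncomputable def shareCount (r : ℕ) (C : O → Finset V) : ℝ :=
  ∑ v, ∑ I ∈ Finset.powersetCard r Finset.univ, shareIndicator v I C

theorem familyExp_shareCount (p : ℝ) (r : ℕ) :
    familyExp p (shareCount r : (O → Finset V) → ℝ) =
      Fintype.card V * ((Fintype.card O).choose r * (pairProb (Fintype.card V) p ^ r *
        (1 - shareProb (Fintype.card V) p) ^ (Fintype.card O - r))) := by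
  unfold shareCount
  rw [familyExp_sum]
  have : ∀ v : V, familyExp p (fun C : O → Finset V =>
      ∑ I ∈ Finset.powersetCard r Finset.univ, shareIndicator v I C) =
      (Fintype.card O).choose r * (pairProb (Fintype.card V) p ^ r *
        (1 - shareProb (Fintype.card V) p) ^ (Fintype.card O - r)) := by
    intro v
    rw [familyExp_sum]
    have h : ∀ I ∈ Finset.powersetCard r (Finset.univ : Finset O),
        familyExp p (fun C => shareIndicator v I C) = pairProb (Fintype.card V) p ^ r *
        (1 - shareProb (Fintype.card V) p) ^ (Fintype.card O - r) := by
      intro I hI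
      rw [← (Finset.mem_powersetCard_univ.1 hI)]
      exact familyExp_shareIndicator p v I
    rw [Finset.sum_congr rfl h]
    simp
  simp_rw [this]
  simp

/-- For equal nodes, distinct `I` and `J` exclude each other, so these pairs contribute at most the
first moment. For distinct nodes the excess correlation is a power of `|I ∩ J|`, summed by
`sum_pow_card_inter_le`. -/
theorem familyExp_shareCount_sq_le {p : ℝ} (h0 : 0 ≤ p) (h1 : p ≤ 1)
    (hb : 0 < pairProb (Fintype.card V) p) {r : ℕ} (hr : r ≤ Fintype.card O)
    (hO : 0 < Fintype.card O) :
    familyExp p (fun C : O → Finset V => shareCount r C ^ 2) ≤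
      familyExp p (shareCount r : (O → Finset V) → ℝ) +
      ((Fintype.card V : ℝ) * (Fintype.card O).choose r) ^ 2 *
        (1 + p ^ 2 / pairProb (Fintype.card V) p ^ 2 * (r / Fintype.card O)) ^ r *
        (pairProb (Fintype.card V) p ^ (2 * r) *
        (1 - 2 * shareProb (Fintype.card V) p + p ^ 2) ^ (Fintype.card O - 2 * r)) := by
  set x := p ^ 2 / pairProb (Fintype.card V) p ^ 2
  set Q := pairProb (Fintype.card V) p ^ (2 * r) *
        (1 - 2 * shareProb (Fintype.card V) p + p ^ 2) ^ (Fintype.card O - 2 * r)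
  set K : ℝ := (Fintype.card O).choose r * (1 + x * (r / Fintype.card O)) ^ r
  have hx : 0 ≤ x := by positivity
  have hd := not_share_prob_nonneg h0 h1 (Fintype.card V)
  have hQ : 0 ≤ Q := by positivity
  have e : (fun C : O → Finset V => shareCount r C ^ 2) = fun C => ∑ v : V, ∑ u : V,
      ∑ I ∈ Finset.powersetCard r Finset.univ, ∑ J ∈ Finset.powersetCard r Finset.univ,
        shareIndicator v I C * shareIndicator u J C := by
    funext C
    rw [sq, shareCount, Finset.sum_mul_sum]
    simp_rw [Finset.sum_mul_sum]
  have hdiag : ∀ v : V, familyExp p (fun C => ∑ I ∈ Finset.powersetCard r (Finset.univ : Finset O),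
      ∑ J ∈ Finset.powersetCard r Finset.univ, shareIndicator v I C * shareIndicator v J C) ≤
      familyExp p (fun C : O → Finset V =>
        ∑ I ∈ Finset.powersetCard r Finset.univ, shareIndicator v I C) := by
    intro v
    refine familyExp_mono h0 h1 fun C => Finset.sum_le_sum fun I hI => ?_
    rw [Finset.sum_eq_single I]
    · exact mul_le_of_le_one_left (shareIndicator_nonneg _ _ _) (shareIndicator_le_one _ _ _)
    · intro J hJ hJI
      refine shareIndicator_mul_eq_zero v hJI.symm ?_ C
      rw [Finset.mem_powersetCard_univ.1 hI, Finset.mem_powersetCard_univ.1 hJ]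
    · exact fun h => absurd hI h
  have hoff : ∀ v u : V, v ≠ u → familyExp p (fun C : O → Finset V =>
      ∑ I ∈ Finset.powersetCard r Finset.univ,
      ∑ J ∈ Finset.powersetCard r Finset.univ, shareIndicator v I C * shareIndicator u J C) ≤
      (Fintype.card O).choose r * (K * Q) := by
    intro v u huv
    rw [familyExp_sum]
    have : ∀ I ∈ Finset.powersetCard r (Finset.univ : Finset O), familyExp p
        (fun C : O → Finset V => ∑ J ∈ Finset.powersetCard r Finset.univ,
          shareIndicator v I C * shareIndicator u J C) ≤ K * Q := by
      intro I hI
      rw [familyExp_sum]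
      have hI' := Finset.mem_powersetCard_univ.1 hI
      calc _ ≤ ∑ J ∈ Finset.powersetCard r (Finset.univ : Finset O), x ^ (I ∩ J).card * Q :=
            Finset.sum_le_sum fun J hJ => familyExp_shareIndicator_mul_le h0 h1 hb huv hI'
              (Finset.mem_powersetCard_univ.1 hJ)
        _ ≤ _ := by
            rw [← Finset.sum_mul]
            exact mul_le_mul_of_nonneg_right (sum_pow_card_inter_le hx r hr hO I hI') hQ
    refine (Finset.sum_le_card_nsmul _ _ _ this).trans_eq ?_
    rw [nsmul_eq_mul, Finset.card_powersetCard, Finset.card_univ]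
  rw [e, familyExp_sum]
  calc _ ≤ ∑ v : V, (familyExp p (fun C : O → Finset V =>
          ∑ I ∈ Finset.powersetCard r Finset.univ, shareIndicator v I C) +
        Fintype.card V * ((Fintype.card O).choose r * (K * Q))) := by
        refine Finset.sum_le_sum fun v _ => ?_
        rw [familyExp_sum, ← Finset.add_sum_erase _ _ (Finset.mem_univ v)]
        refine add_le_add (hdiag v) ?_
        refine (Finset.sum_le_card_nsmul _ _ ((Fintype.card O).choose r * (K * Q))
          fun u hu => hoff v u (Finset.ne_of_mem_erase hu).symm).trans ?_
        rw [nsmul_eq_mul]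
        gcongr
        exact Finset.card_erase_le
    _ = _ := by
        rw [Finset.sum_add_distrib, ← familyExp_sum, Finset.sum_const, nsmul_eq_mul,
          Finset.card_univ]
        unfold shareCount
        ring

/-- The second moment bound for the probability that no node shares precisely `r` objects with
other nodes. -/
theorem familyExp_shareCount_eq_zero_le {p : ℝ} (h0 : 0 ≤ p) (h1 : p ≤ 1)
    (hb : 0 < pairProb (Fintype.card V) p) (hc : shareProb (Fintype.card V) p < 1) {r : ℕ}
    (hr : 2 * r ≤ Fintype.card O) (hO : 0 < Fintype.card O) (hV : 0 < Fintype.card V) :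
    familyExp p (Set.indicator {C : O → Finset V | shareCount r C = 0} 1) ≤
      (Fintype.card V * ((Fintype.card O).choose r * (pairProb (Fintype.card V) p ^ r *
        (1 - shareProb (Fintype.card V) p) ^ (Fintype.card O - r))))⁻¹ +
      ((1 + p ^ 2 / pairProb (Fintype.card V) p ^ 2 * (r / Fintype.card O)) ^ r *
        ((1 - 2 * shareProb (Fintype.card V) p + p ^ 2) ^ (Fintype.card O - 2 * r) /
        (1 - shareProb (Fintype.card V) p) ^ (2 * (Fintype.card O - r))) - 1) := by
  have hsq := familyExp_shareCount_sq_le h0 h1 hb (show r ≤ Fintype.card O by omega) hO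
  have hm := familyExp_shareCount (V := V) (O := O) p r
  set m := familyExp p (shareCount r : (O → Finset V) → ℝ)
  have hC : 0 < (Fintype.card O).choose r := Nat.choose_pos (by omega)
  have hc' : 0 < 1 - shareProb (Fintype.card V) p := by linarith
  have hm0 : 0 < m := by rw [hm]; positivity
  rw [← hm]
  -- Chebyshev's inequality pointwise: the indicator of `X = 0` is at most `(X / m - 1) ^ 2`.
  have hle : ∀ C : O → Finset V, Set.indicator {C : O → Finset V | shareCount r C = 0} 1 C ≤
      (m⁻¹ ^ 2) * shareCount r C ^ 2 + ((-2 * m⁻¹) * shareCount r C + 1) := by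
    intro C
    have e : (m⁻¹ ^ 2) * shareCount r C ^ 2 + ((-2 * m⁻¹) * shareCount r C + 1) =
        (m⁻¹ * shareCount r C - 1) ^ 2 := by ring
    rw [e]
    by_cases h : shareCount r C = 0
    · rw [Set.indicator_of_mem (by simpa using h), h]; norm_num
    · rw [Set.indicator_of_notMem (by simpa using h)]; positivity
  refine (familyExp_mono h0 h1 hle).trans ?_
  rw [familyExp_add, familyExp_add, familyExp_const_mul, familyExp_const_mul, familyExp_one]
  have h2 := mul_le_mul_of_nonneg_left hsq (sq_nonneg m⁻¹)
  have h3 : -2 * m⁻¹ * m + 1 = -1 := by field_simp; norm_num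
  change m⁻¹ ^ 2 * _ + (-2 * m⁻¹ * m + 1) ≤ _
  rw [h3]
  refine (add_le_add_left h2 (-1)).trans_eq ?_
  rw [mul_add, show m⁻¹ ^ 2 * m = m⁻¹ by field_simp, add_assoc, sub_eq_add_neg]
  congr 2
  rw [hm, pow_mul' (pairProb (Fintype.card V) p), pow_mul' (1 - shareProb (Fintype.card V) p)]
  field_simp

/-- A node that shares precisely `k - 1` objects with other nodes, each of them with one other node,
prevents `k`-robustness. -/
theorem shareCount_eq_zero_of_isKRobust {k : ℕ} (hk : 1 ≤ k) (hV : 2 ≤ Fintype.card V)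
    (S : V → Finset O)
    (h : IsKRobust k (objectIntersectionGraph fun i => (S i : Set O))) :
    shareCount (k - 1) (holdersEquiv S) = 0 := by
  refine Finset.sum_eq_zero fun v _ => Finset.sum_eq_zero fun I hI => ?_
  by_contra hne
  have hI := Finset.mem_powersetCard_univ.1 hI
  have hf : ∀ o, shareFactor v I o (holdersEquiv S o) ≠ 0 := fun o =>
    Finset.prod_ne_zero_iff.1 hne o (Finset.mem_univ o)
  set G := objectIntersectionGraph fun i => (S i : Set O)
  have hmem : ∀ u o, u ∈ holdersEquiv S o ↔ o ∈ S u := by intro u o; simp [holdersEquiv]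
  have hsub : G.neighborSet v ⊆ ((I.biUnion fun o => (holdersEquiv S o).erase v : Finset V) :
      Set V) := by
    rintro u ⟨huv, o, ho1, ho2⟩
    have hv : v ∈ holdersEquiv S o := (hmem v o).2 (by simpa using ho1)
    have hu : u ∈ holdersEquiv S o := (hmem u o).2 (by simpa using ho2)
    have hoI : o ∈ I := by
      by_contra hoI
      refine hf o ?_
      unfold shareFactor
      have h2 : 2 ≤ (holdersEquiv S o).card := by
        rw [← Finset.card_pair huv]
        exact Finset.card_le_card (by simp [Finset.insert_subset_iff, hv, hu])
      rw [if_neg hoI, if_pos ⟨hv, h2⟩]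
    simp only [Finset.coe_biUnion, Set.mem_iUnion]
    exact ⟨o, hoI, by simpa using ⟨hu, Ne.symm huv⟩⟩
  have hcard : (I.biUnion fun o => (holdersEquiv S o).erase v).card ≤ k - 1 := by
    rw [← hI, ← mul_one I.card]
    refine Finset.card_biUnion_le_card_mul _ _ _ fun o ho => Nat.le_of_eq ?_
    have := hf o
    unfold shareFactor at this
    rw [if_pos ho] at this
    have h2 : v ∈ holdersEquiv S o ∧ (holdersEquiv S o).card = 2 := by
      by_contra h2
      exact this (if_neg h2)
    simp [Finset.card_erase_of_mem h2.1, h2.2]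
  have hdeg : (G.neighborSet v).encard < k := by
    refine (Set.encard_le_encard hsub).trans_lt ?_
    rw [Set.encard_coe_eq_coe_finsetCard]
    exact_mod_cast (by omega : _ < k)
  have hnt : ({v} : Set V) ≠ Set.univ := by
    intro he
    have : Fintype.card V ≤ 1 := Fintype.card_le_one_iff.2 fun a b => by
      have ha : a ∈ ({v} : Set V) := he ▸ Set.mem_univ a
      have hb : b ∈ ({v} : Set V) := he ▸ Set.mem_univ b
      rw [Set.mem_singleton_iff.1 ha, Set.mem_singleton_iff.1 hb]
    omega
  -- In case (b) a node has at most one neighbor in `{v}`, which forces `k ≤ 1`, while the same edge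
  -- gives `v` a neighbor; this again contradicts degree below `k`.
  rcases h {v} (Set.singleton_nonempty v) hnt with ⟨a, ha, hk'⟩ | ⟨b, hb, hk'⟩
  · rw [Set.mem_singleton_iff.1 ha] at hk'
    exact absurd ((hk'.trans (Set.encard_le_encard Set.inter_subset_left)).trans_lt hdeg)
      (lt_irrefl _)
  · have h1 : (k : ℕ∞) ≤ 1 := hk'.trans ((Set.encard_le_encard Set.inter_subset_right).trans
      (Set.encard_singleton v).le)
    have hpos : 0 < (G.neighborSet b ∩ {v}).encard :=
      lt_of_lt_of_le (by exact_mod_cast hk) hk'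
    obtain ⟨w, hw, hwv⟩ := Set.encard_pos.1 hpos
    rw [Set.mem_singleton_iff.1 hwv] at hw
    have hbv : b ∈ G.neighborSet v := (show G.Adj b v from hw).symm
    have h2 : (1 : ℕ∞) ≤ (G.neighborSet v).encard :=
      Set.one_le_encard_iff_nonempty.2 ⟨b, hbv⟩
    exact absurd ((h1.trans h2).trans_lt hdeg) (lt_irrefl _)

end SecondMoment

/-! ### Asymptotics of the mean degree and the pool size. -/

section Asymptotic

theorem tendsto_meanDegree_div_log {k : ℕ} {α L : ℕ → ℝ}
    (hL : ∀ n : ℕ, 2 ≤ n → L n = Real.log n + ((k : ℝ) - 1) * Real.log (Real.log n) + α n)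
    (hαo : (fun n : ℕ => |α n|) =o[atTop] (fun n : ℕ => Real.log n)) :
    Tendsto (fun n : ℕ => L n / Real.log n) atTop (𝓝 1) := by
  have hlog : Tendsto (fun n : ℕ => Real.log n) atTop atTop :=
    Real.tendsto_log_atTop.comp tendsto_natCast_atTop_atTop
  have h1 : Tendsto (fun n : ℕ => α n / Real.log n) atTop (𝓝 0) :=
    ((isLittleO_abs_left.1 hαo)).tendsto_div_nhds_zero
  have h2 : Tendsto (fun n : ℕ => Real.log (Real.log n) / Real.log n) atTop (𝓝 0) :=
    (Real.isLittleO_log_id_atTop.comp_tendsto hlog).tendsto_div_nhds_zero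
  have h3 : Tendsto (fun n : ℕ => 1 + ((k : ℝ) - 1) * (Real.log (Real.log n) / Real.log n) +
      α n / Real.log n) atTop (𝓝 (1 + ((k : ℝ) - 1) * 0 + 0)) :=
    (tendsto_const_nhds.add (h2.const_mul _)).add h1
  rw [mul_zero, add_zero, add_zero] at h3
  refine h3.congr' ?_
  filter_upwards [eventually_ge_atTop 2] with n hn
  have : 0 < Real.log n := Real.log_pos (by exact_mod_cast hn)
  rw [hL n hn]
  field_simp

/-- The term `(k - 1) ln ln n` supplies `(ln n) ^ (k - 1)`, which cancels `L ^ (k - 1)` up to a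
factor tending to `1`; only `α` decides the limit. -/
theorem exp_neg_meanDegree {k : ℕ} (hk : 1 ≤ k) {α L : ℕ → ℝ}
    (hL : ∀ n : ℕ, 2 ≤ n → L n = Real.log n + ((k : ℝ) - 1) * Real.log (Real.log n) + α n)
    {n : ℕ} (hn : 2 ≤ n) :
    n * L n ^ (k - 1) * Real.exp (-L n) = (L n / Real.log n) ^ (k - 1) * Real.exp (-α n) := by
  have h0 : (0 : ℝ) < n := by positivity
  have h1 : 0 < Real.log n := Real.log_pos (by exact_mod_cast hn)
  have e : Real.exp (-L n) = (n : ℝ)⁻¹ * (Real.log n ^ (k - 1))⁻¹ * Real.exp (-α n) := by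
    rw [hL n hn, neg_add, neg_add, Real.exp_add, Real.exp_add, Real.exp_neg, Real.exp_log h0,
      Real.exp_neg (_ * _)]
    congr 3
    rw [← Nat.cast_one, ← Nat.cast_sub hk, Real.exp_nat_mul, Real.exp_log h1]
  rw [e, div_pow]
  field_simp

theorem tendsto_pow_meanDegree_div {L : ℕ → ℝ}
    (h1 : Tendsto (fun n : ℕ => L n / Real.log n) atTop (𝓝 1)) (j : ℕ) :
    Tendsto (fun n : ℕ => L n ^ j / n) atTop (𝓝 0) := by
  have h2 : Tendsto (fun n : ℕ => Real.log n ^ j / (n : ℝ)) atTop (𝓝 0) :=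
    ((Real.isLittleO_pow_log_id_atTop (n := j)).comp_tendsto
      tendsto_natCast_atTop_atTop).tendsto_div_nhds_zero
  have h3 := (h1.pow j).mul h2
  rw [mul_zero] at h3
  refine h3.congr' ?_
  filter_upwards [eventually_ge_atTop 2] with n hn
  have : 0 < Real.log n := Real.log_pos (by exact_mod_cast hn)
  rw [div_pow]
  field_simp

theorem tendsto_meanDegree_atTop {L : ℕ → ℝ}
    (h1 : Tendsto (fun n : ℕ => L n / Real.log n) atTop (𝓝 1)) : Tendsto L atTop atTop := by
  have hlog : Tendsto (fun n : ℕ => Real.log n) atTop atTop :=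
    Real.tendsto_log_atTop.comp tendsto_natCast_atTop_atTop
  refine (h1.pos_mul_atTop one_pos hlog).congr' ?_
  filter_upwards [eventually_ge_atTop 2] with n hn
  have : 0 < Real.log n := Real.log_pos (by exact_mod_cast hn)
  field_simp

theorem tendsto_poolSize {P : ℕ → ℕ}
    (hP : (fun n : ℕ => (n : ℝ) * Real.log n ^ 5) =O[atTop] (fun n : ℕ => (P n : ℝ))) :
    Tendsto P atTop atTop := by
  have hlog : Tendsto (fun n : ℕ => Real.log n) atTop atTop :=
    Real.tendsto_log_atTop.comp tendsto_natCast_atTop_atTop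
  have h1 : Tendsto (fun n : ℕ => (n : ℝ) * Real.log n ^ 5) atTop atTop :=
    tendsto_natCast_atTop_atTop.atTop_mul_atTop₀ ((tendsto_pow_atTop (by norm_num)).comp hlog)
  obtain ⟨C, hC, h⟩ := hP.exists_pos
  have h2 : Tendsto (fun n => C * (P n : ℝ)) atTop atTop := by
    refine tendsto_atTop_mono' _ ?_ h1
    filter_upwards [h.bound] with n hn
    rw [Real.norm_eq_abs, Real.norm_eq_abs, Nat.abs_cast] at hn
    exact (le_abs_self _).trans hn
  have h3 := h2.const_mul_atTop (inv_pos.2 hC)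
  refine tendsto_natCast_atTop_iff.1 (h3.congr fun n => ?_)
  field_simp

/-- Eliminating `p` gives `(n p L) ^ 2 = n L ^ 3 / P`, which is `O(1 / (ln n) ^ 2)` by the growth of
`P`. -/
theorem tendsto_mul_prob_mul_meanDegree {p L : ℕ → ℝ} {P : ℕ → ℕ} (h0 : ∀ n, 0 ≤ p n)
    (hL : ∀ n, L n = n * (p n ^ 2 * P n))
    (h1 : Tendsto (fun n : ℕ => L n / Real.log n) atTop (𝓝 1))
    (hP : (fun n : ℕ => (n : ℝ) * Real.log n ^ 5) =O[atTop] (fun n : ℕ => (P n : ℝ))) :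
    Tendsto (fun n : ℕ => n * p n * L n) atTop (𝓝 0) := by
  have hlog : Tendsto (fun n : ℕ => Real.log n) atTop atTop :=
    Real.tendsto_log_atTop.comp tendsto_natCast_atTop_atTop
  obtain ⟨C, hC, h⟩ := hP.exists_pos
  have hlim : Tendsto (fun n : ℕ => C * ((L n / Real.log n) ^ 3 * (Real.log n ^ 2)⁻¹)) atTop
      (𝓝 (C * (1 ^ 3 * 0))) :=
    ((h1.pow 3).mul (tendsto_inv_atTop_zero.comp
      ((tendsto_pow_atTop two_ne_zero).comp hlog))).const_mul C
  rw [mul_zero, mul_zero] at hlim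
  have hLn : ∀ n, 0 ≤ L n := fun n => by
    have := h0 n
    rw [hL]; positivity
  have hsq : Tendsto (fun n : ℕ => (n * p n * L n) ^ 2) atTop (𝓝 0) := by
    refine squeeze_zero' (Eventually.of_forall fun n => sq_nonneg _) ?_ hlim
    filter_upwards [eventually_ge_atTop 2, h.bound,
      (tendsto_poolSize hP).eventually_gt_atTop 0] with n hn hb hPn
    have hl : 0 < Real.log n := Real.log_pos (by exact_mod_cast hn)
    have hPn' : (0 : ℝ) < P n := by exact_mod_cast hPn
    rw [Real.norm_eq_abs, Real.norm_eq_abs, Nat.abs_cast] at hb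
    have hb := (le_abs_self _).trans hb
    have hn0 : (0 : ℝ) < n := by positivity
    have e1 : (n * p n * L n) ^ 2 = n * L n ^ 3 / P n := by
      rw [eq_div_iff hPn'.ne']
      have := hL n
      calc _ = n * L n ^ 2 * (n * (p n ^ 2 * P n)) := by ring
        _ = _ := by rw [← hL n]; ring
    have e2 : C * ((L n / Real.log n) ^ 3 * (Real.log n ^ 2)⁻¹) =
        C * L n ^ 3 / Real.log n ^ 5 := by field_simp
    rw [e1, e2, div_le_div_iff₀ hPn' (by positivity)]
    have := mul_le_mul_of_nonneg_left hb (pow_nonneg (hLn n) 3)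
    nlinarith
  have := hsq.sqrt
  rw [Real.sqrt_zero] at this
  refine this.congr fun n => Real.sqrt_sq ?_
  have := h0 n
  have := hLn n
  positivity

end Asymptotic

/-! ### Summation of the union bound over node sets. -/

section OneLaw

/-- From `n.choose m ≤ n ^ m / m!` and `m ^ m / m! ≤ e ^ m`, the sets of size `m` contribute at most
`(ρ e) ^ m`. A factor `m` in the bound on `n * a m` is therefore affordable. -/
theorem sum_finset_pow_le {V : Type*} [Fintype V] [DecidableEq V] (a : ℕ → ℝ) {ρ : ℝ}
    (ha : ∀ m, 0 ≤ a m) (hρ0 : 0 ≤ ρ) (hρ : ρ * Real.exp 1 ≤ 1 / 2)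
    (h : ∀ m, 1 ≤ m → 2 * m ≤ Fintype.card V → Fintype.card V * a m ≤ ρ * m) :
    ∑ T : Finset V with T.Nonempty ∧ 2 * T.card ≤ Fintype.card V, a T.card ^ T.card ≤
      2 * (ρ * Real.exp 1) := by
  set n := Fintype.card V
  set f : ℕ → ℝ := fun m => if 1 ≤ m ∧ 2 * m ≤ n then a m ^ m else 0
  set δ := ρ * Real.exp 1
  have hδ : 0 ≤ δ := by positivity
  calc _ = ∑ T ∈ (Finset.univ : Finset V).powerset, f T.card := by
        rw [Finset.sum_filter, Finset.powerset_univ]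
        refine Finset.sum_congr rfl fun T _ => ?_
        simp only [f, Nat.one_le_iff_ne_zero, ← Nat.pos_iff_ne_zero, Finset.card_pos]
    _ = ∑ m ∈ Finset.range (n + 1), n.choose m • f m := by
        rw [Finset.sum_powerset_apply_card, Finset.card_univ]
    _ ≤ ∑ m ∈ Finset.range (n + 1), if 1 ≤ m then δ ^ m else 0 := by
        refine Finset.sum_le_sum fun m _ => ?_
        by_cases hm : 1 ≤ m ∧ 2 * m ≤ n
        · simp only [f]
          rw [if_pos hm, if_pos hm.1, nsmul_eq_mul]
          have hc : (n.choose m : ℝ) ≤ (n : ℝ) ^ m / m.factorial := Nat.choose_le_pow_div m n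
          have hf : (m : ℝ) ^ m / m.factorial ≤ Real.exp 1 ^ m := by
            have := Real.pow_div_factorial_le_exp (m : ℝ) (Nat.cast_nonneg m) m
            rwa [← mul_one (m : ℝ), Real.exp_nat_mul, mul_one] at this
          calc _ ≤ (n : ℝ) ^ m / m.factorial * a m ^ m :=
                mul_le_mul_of_nonneg_right hc (pow_nonneg (ha m) m)
            _ = (n * a m) ^ m / m.factorial := by rw [mul_pow]; ring
            _ ≤ (ρ * m) ^ m / m.factorial := by
                have := h m hm.1 hm.2
                have h2 : 0 ≤ (n : ℝ) * a m := mul_nonneg (Nat.cast_nonneg _) (ha m)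
                gcongr
            _ = ρ ^ m * ((m : ℝ) ^ m / m.factorial) := by rw [mul_pow]; ring
            _ ≤ ρ ^ m * Real.exp 1 ^ m := by gcongr
            _ = _ := (mul_pow _ _ _).symm
        · simp only [f]
          rw [if_neg hm, smul_zero]
          split_ifs <;> positivity
    _ ≤ 2 * δ := by
        rw [Finset.sum_range_succ']
        simp only [Nat.le_add_left, if_true, nonpos_iff_eq_zero, one_ne_zero, if_false, add_zero]
        have hg := geom_sum_mul_neg δ n
        have h1 : 0 ≤ ∑ i ∈ Finset.range n, δ ^ i := Finset.sum_nonneg fun _ _ => by positivity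
        have h2 : ∑ i ∈ Finset.range n, δ ^ (i + 1) = δ * ∑ i ∈ Finset.range n, δ ^ i := by
          rw [Finset.mul_sum]; exact Finset.sum_congr rfl fun _ _ => by ring
        rw [h2]
        have h3 : 0 ≤ δ ^ n := by positivity
        have h4 : ∑ i ∈ Finset.range n, δ ^ i ≤ 2 := by nlinarith
        nlinarith

/-- For `m ≤ 2` the exponent is at most `3`. For `m ≥ 3`, `ln x / x` decreases beyond `e`, so `m ≤ n
/ 2` gives `ln m / m ≥ 2 ln (n / 2) / n`; the assumption `ln 2 ≤ (ln n) / 4` makes this at least `L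
/ n`. -/
theorem exp_mul_div_le {n m : ℕ} {L : ℝ} (hL : L ≤ 3 / 2 * Real.log n)
    (hn : 4 * Real.log 2 ≤ Real.log n) (hm : 1 ≤ m) (hmn : 2 * m ≤ n) :
    Real.exp (m * L / n) ≤ Real.exp 3 * m := by
  have hm0 : (1 : ℝ) ≤ m := by exact_mod_cast hm
  have hmn' : 2 * (m : ℝ) ≤ n := by exact_mod_cast hmn
  have hn0 : (0 : ℝ) < n := by linarith
  rw [← Real.exp_log (show (0 : ℝ) < m by linarith), ← Real.exp_add, Real.exp_log (by linarith),
    Real.exp_le_exp, div_le_iff₀ hn0]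
  have hlm := Real.log_nonneg hm0
  have hln : Real.log n ≤ n := (Real.log_le_sub_one_of_pos hn0).trans (by linarith)
  rcases le_or_gt m 2 with h | h
  · have h2 : (m : ℝ) ≤ 2 := by exact_mod_cast h
    have : 0 ≤ Real.log n := Real.log_nonneg (by linarith)
    nlinarith
  · have h3 : (3 : ℝ) ≤ m := by exact_mod_cast h
    have he : Real.exp 1 ≤ 3 := by linarith [Real.exp_one_lt_d9]
    have := Real.log_div_self_antitoneOn (Set.mem_Ici.2 (he.trans h3))
      (Set.mem_Ici.2 (show Real.exp 1 ≤ (n : ℝ) / 2 by linarith))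
      (show (m : ℝ) ≤ n / 2 by linarith)
    simp only at this
    rw [Real.log_div hn0.ne' two_ne_zero, div_le_div_iff₀ (by positivity) (by positivity)] at this
    nlinarith

end OneLaw

/-! ### Explicit bounds in terms of the mean degree, and passage to the limit. -/

section Limits

open Classical in
theorem probBinomialRIGRobust_add (k n P : ℕ) (p : unitInterval) :
    probBinomialRIGRobust k n P p + familyExp (p : ℝ) (Set.indicator
      {S : Fin n → Finset (Fin P) |
        ¬ IsKRobust k (objectIntersectionGraph fun i => (S i : Set (Fin P)))} 1) = 1 := by
  rw [probBinomialRIGRobust_eq, ← familyExp_add]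
  refine Eq.trans (congrArg _ (funext fun S => ?_)) (familyExp_one (p : ℝ))
  by_cases h : IsKRobust k (objectIntersectionGraph fun i => (S i : Set (Fin P)))
  · rw [if_pos h, Set.indicator_of_notMem (by simpa using h), add_zero]
  · rw [if_neg h, Set.indicator_of_mem (by simpa using h), zero_add, Pi.one_apply]

/-- The bound for the probability of non-robustness in terms of the mean degree `L`. -/
theorem not_isKRobust_le_of_meanDegree {k n P : ℕ} (hk : 1 ≤ k) {p L : ℝ} (h0 : 0 ≤ p) (h1 : p ≤ 1)
    (hn : 1 ≤ n) (hL : L = n * (p ^ 2 * P)) (hL1 : 1 ≤ L) (hL2 : L ≤ 3 / 2 * Real.log n)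
    (hlog : 4 * Real.log 2 ≤ Real.log n)
    (hρ : (n * L ^ (k - 1) * Real.exp (-L)) * Real.exp 6 ≤ 1 / 2) :
    familyExp p (Set.indicator {S : Fin n → Finset (Fin P) |
        ¬ IsKRobust k (objectIntersectionGraph fun i => (S i : Set (Fin P)))} 1) ≤
      Real.sqrt (n * p * L) + 2 * (n * p * L) + L ^ 2 / n +
        2 * ((n * L ^ (k - 1) * Real.exp (-L)) * Real.exp 6) := by
  have hn0 : (0 : ℝ) < n := by exact_mod_cast hn
  have hn1 : (1 : ℝ) ≤ n := by exact_mod_cast hn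
  have hpP : 0 < p ^ 2 * P := by
    by_contra h
    have := mul_le_mul_of_nonneg_left (not_lt.1 h) hn0.le
    rw [mul_zero] at this
    linarith
  have hp : 0 < p := lt_of_le_of_ne h0 fun h => by simp [← h] at hpP
  have hP : (0 : ℝ) < P := by
    by_contra h
    have := mul_le_mul_of_nonneg_left (not_lt.1 h) (sq_nonneg p)
    linarith
  have hμ : 0 < (P : ℝ) * p := by positivity
  have hL0 : 0 < L := by linarith
  -- The scale of the standard deviation of a set size balances the two terms involving `t`; their
  -- cost becomes `n p t = √(n p L)`.
  set t := Real.sqrt (P * p)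
  have ht : 0 < t := Real.sqrt_pos.2 hμ
  have htt : t ^ 2 = P * p := Real.sq_sqrt hμ.le
  -- With `z = 1 / L` the price `z⁻¹ ^ (k - 1)` is only `L ^ (k - 1)`, while `(1 - z) L = L - 1`
  -- loses just a constant in the exponent.
  have hmain := familyExp_not_isKRobust_le (V := Fin n) (O := Fin P) hk h0 h1
    (inv_pos.2 hL0) (inv_le_one_of_one_le₀ hL1) ht
  simp only [Fintype.card_fin] at hmain
  refine hmain.trans ?_
  refine add_le_add ?_ ?_
  · have e1 : P * p / (2 * t) + t / 2 = t := by
      rw [← htt]; field_simp; norm_num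
    have e2 : n * p * t = Real.sqrt (n * p * L) := by
      rw [eq_comm, Real.sqrt_eq_iff_mul_self_eq (by positivity) (by positivity), hL]
      calc _ = n * p * (n * p) * (P * p) := by ring
        _ = _ := by rw [← htt]; ring
    have e3 : n * (p ^ 2 * (P * p)) = p * L := by rw [hL]; ring
    have e4 : n * (p ^ 2 * (P * p) ^ 2) = L ^ 2 / n := by
      rw [hL]; field_simp
    have e5 : p * L ≤ n * p * L := by
      rw [mul_assoc]; exact le_mul_of_one_le_left (by positivity) hn1
    calc _ = n * p * t + n * p * (n * (p ^ 2 * P)) + n * (p ^ 2 * (P * p) ^ 2) +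
          n * (p ^ 2 * (P * p)) := by rw [e1]; ring
      _ ≤ _ := by rw [e2, e3, e4, ← hL]; linarith
  · rw [inv_inv]
    set a : ℕ → ℝ := fun m => L ^ (k - 1) * Real.exp 2 * Real.exp (-L) * Real.exp (m * L / n)
    have hterm : ∀ T : Finset (Fin n), L ^ (k - 1) * Real.exp (-((1 - L⁻¹) *
        ((Tᶜ.card : ℝ) * (p * (P * p)) - 1))) ≤ a T.card := by
      intro T
      simp only [a, mul_assoc]
      rw [← Real.exp_add, ← Real.exp_add]
      refine mul_le_mul_of_nonneg_left (Real.exp_le_exp.2 ?_) (by positivity)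
      rw [Finset.card_compl, Fintype.card_fin, Nat.cast_sub (by simpa using T.card_le_univ)]
      have e : ((n : ℝ) - T.card) * (p * (P * p)) = L - T.card * L / n := by
        rw [hL]; field_simp
      rw [e]
      have hx : (0 : ℝ) ≤ T.card * L / n := by positivity
      have hz : L⁻¹ * L = 1 := inv_mul_cancel₀ hL0.ne'
      have hz0 : 0 < L⁻¹ := inv_pos.2 hL0
      have := mul_nonneg hz0.le hx
      nlinarith
    -- `exp 5` combines `exp 2`, lost to `z` and to the fluctuation bound, with `exp 3` from
    -- `exp_mul_div_le`; the series adds one more factor `e`.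
    have hs := sum_finset_pow_le (V := Fin n) a (ρ := n * L ^ (k - 1) * Real.exp (-L) * Real.exp 5)
      (fun m => by positivity) (by positivity) ?_ ?_
    · rw [mul_assoc _ (Real.exp 5), ← Real.exp_add] at hs
      norm_num at hs
      refine le_trans (Finset.sum_le_sum fun T _ => ?_) hs
      exact pow_le_pow_left₀ (by positivity) (hterm T) _
    · rw [mul_assoc _ (Real.exp 5), ← Real.exp_add]
      norm_num
      linarith
    · intro m hm hmn
      rw [Fintype.card_fin] at hmn ⊢
      have := exp_mul_div_le hL2 hlog hm hmn
      calc (n : ℝ) * a m ≤ n * (L ^ (k - 1) * Real.exp 2 * Real.exp (-L) * (Real.exp 3 * m)) := by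
            simp only [a]; gcongr
        _ = n * L ^ (k - 1) * Real.exp (-L) * (Real.exp 2 * Real.exp 3) * m := by ring
        _ = _ := by rw [← Real.exp_add]; norm_num

theorem tendsto_probBinomialRIGRobust_one {k : ℕ} (hk : 1 ≤ k) {P : ℕ → ℕ} {p : ℕ → unitInterval}
    {α L : ℕ → ℝ} (hLp : ∀ n, L n = n * ((p n : ℝ) ^ 2 * P n))
    (hL : ∀ n : ℕ, 2 ≤ n → L n = Real.log n + ((k : ℝ) - 1) * Real.log (Real.log n) + α n)
    (hP : (fun n : ℕ => (n : ℝ) * Real.log n ^ 5) =O[atTop] (fun n : ℕ => (P n : ℝ)))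
    (hLlog : Tendsto (fun n : ℕ => L n / Real.log n) atTop (𝓝 1))
    (hα : Tendsto α atTop atTop) :
    Tendsto (fun n : ℕ => probBinomialRIGRobust k n (P n) (p n)) atTop (𝓝 1) := by
  have hlog : Tendsto (fun n : ℕ => Real.log n) atTop atTop :=
    Real.tendsto_log_atTop.comp tendsto_natCast_atTop_atTop
  have hη := tendsto_mul_prob_mul_meanDegree (fun n => (p n).2.1) hLp hLlog hP
  have hρ : Tendsto (fun n : ℕ => n * L n ^ (k - 1) * Real.exp (-L n) * Real.exp 6) atTop
      (𝓝 0) := by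
    have h1 : Tendsto (fun n => (L n / Real.log n) ^ (k - 1) * Real.exp (-α n) * Real.exp 6) atTop
        (𝓝 (1 ^ (k - 1) * 0 * Real.exp 6)) :=
      ((hLlog.pow _).mul (Real.tendsto_exp_neg_atTop_nhds_zero.comp hα)).mul_const _
    rw [mul_zero, zero_mul] at h1
    refine h1.congr' ?_
    filter_upwards [eventually_ge_atTop 2] with n hn
    rw [exp_neg_meanDegree hk hL hn]
  have hbound : Tendsto (fun n : ℕ => 1 - (Real.sqrt (n * (p n : ℝ) * L n) + 2 * (n * (p n : ℝ) * L n) +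
      L n ^ 2 / n + 2 * (n * L n ^ (k - 1) * Real.exp (-L n) * Real.exp 6))) atTop (𝓝 1) := by
    have := ((((hη.sqrt).add (hη.const_mul 2)).add (tendsto_pow_meanDegree_div hLlog 2)).add
      (hρ.const_mul 2)).const_sub 1
    simpa using this
  refine tendsto_of_tendsto_of_tendsto_of_le_of_le' hbound tendsto_const_nhds ?_ ?_
  · filter_upwards [eventually_ge_atTop 2, (tendsto_meanDegree_atTop hLlog).eventually_ge_atTop 1,
      hlog.eventually_ge_atTop (4 * Real.log 2),
      hρ.eventually_le_const (show (0 : ℝ) < 1 / 2 by norm_num),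
      hLlog.eventually_le_const (show (1 : ℝ) < 3 / 2 by norm_num)] with n hn h1 h2 h3 h4
    have hl : 0 < Real.log n := Real.log_pos (by exact_mod_cast hn)
    rw [div_le_iff₀ hl] at h4
    have := not_isKRobust_le_of_meanDegree hk (p n).2.1 (p n).2.2 (by omega) (hLp n) h1 h4 h2 h3
    have e := probBinomialRIGRobust_add k n (P n) (p n)
    linarith
  · refine Eventually.of_forall fun n => ?_
    have e := probBinomialRIGRobust_add k n (P n) (p n)
    have : 0 ≤ familyExp (p n : ℝ) (Set.indicator {S : Fin n → Finset (Fin (P n)) |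
        ¬ IsKRobust k (objectIntersectionGraph fun i => (S i : Set (Fin (P n))))} 1) :=
      familyExp_nonneg (p n).2.1 (p n).2.2 fun S => Set.indicator_nonneg (fun _ _ => zero_le_one) S
    linarith

theorem probBinomialRIGRobust_le_shareCount {k n : ℕ} (hk : 1 ≤ k) (hn : 2 ≤ n) (P : ℕ)
    (p : unitInterval) :
    probBinomialRIGRobust k n P p ≤ familyExp (p : ℝ)
      (Set.indicator {C : Fin P → Finset (Fin n) | shareCount (k - 1) C = 0} 1) := by
  classical
  rw [probBinomialRIGRobust_eq, ← familyExp_holders (V := Fin n) (O := Fin P) (p : ℝ)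
    (Set.indicator {C : Fin P → Finset (Fin n) | shareCount (k - 1) C = 0} 1)]
  refine familyExp_mono p.2.1 p.2.2 fun S => ?_
  split_ifs with h
  · rw [Set.indicator_of_mem]
    · simp
    · exact shareCount_eq_zero_of_isKRobust hk (by simpa using hn) S h
  · exact Set.indicator_nonneg (fun _ _ => zero_le_one) _

theorem shareProb_nonneg {p : ℝ} (h0 : 0 ≤ p) (h1 : p ≤ 1) (n : ℕ) : 0 ≤ shareProb n p := by
  have : (1 - p) ^ (n - 1) ≤ 1 := pow_le_one₀ (by linarith) (by linarith)
  unfold shareProb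
  nlinarith

theorem shareProb_le_mul_sq {p : ℝ} (h0 : 0 ≤ p) (h1 : p ≤ 1) (n : ℕ) :
    shareProb n p ≤ n * p ^ 2 := by
  have h := one_add_mul_le_pow (show (-2 : ℝ) ≤ -p by linarith) (n - 1)
  have hn : ((n - 1 : ℕ) : ℝ) ≤ n := by exact_mod_cast Nat.sub_le n 1
  rw [← sub_eq_add_neg] at h
  unfold shareProb
  have h3 := mul_le_mul_of_nonneg_left h h0
  have h4 := mul_le_mul_of_nonneg_right hn (sq_nonneg p)
  nlinarith

theorem le_pairProb {p : ℝ} (h0 : 0 ≤ p) (h1 : p ≤ 1) {n : ℕ} (hn : 2 ≤ n)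
    (hnp : n * p ≤ 1 / 2) : n * p ^ 2 / 4 ≤ pairProb n p := by
  have h := one_add_mul_le_pow (show (-2 : ℝ) ≤ -p by linarith) (n - 2)
  rw [← sub_eq_add_neg, Nat.cast_sub hn] at h
  have h2 : 1 / 2 ≤ (1 - p) ^ (n - 2) := by push_cast at h; nlinarith
  have h3 : (n : ℝ) / 2 ≤ ((n - 1 : ℕ) : ℝ) := by
    rw [Nat.cast_sub (by omega)]
    have : (2 : ℝ) ≤ n := by exact_mod_cast hn
    push_cast; linarith
  unfold pairProb
  calc n * p ^ 2 / 4 = n / 2 * (p ^ 2 * (1 / 2)) := by ring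
    _ ≤ _ := by gcongr

/-- Since `1 - 2 c + p ^ 2 ≤ (1 - c) ^ 2 + p ^ 2` and `(1 - c) ^ 2 ≥ 1 / 4`, each object costs a
factor of at most `1 + 4 p ^ 2` over independence. -/
theorem not_share_pow_div_le {p c : ℝ} (hc : c ≤ 1 / 2)
    (hd : 0 ≤ 1 - 2 * c + p ^ 2) {N r : ℕ} (hr : 2 * r ≤ N) :
    (1 - 2 * c + p ^ 2) ^ (N - 2 * r) / (1 - c) ^ (2 * (N - r)) ≤
      Real.exp (4 * (p ^ 2 * N)) / (1 - c) ^ (2 * r) := by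
  have h1 : 0 < 1 - c := by linarith
  have h2 : 1 - 2 * c + p ^ 2 ≤ (1 - c) ^ 2 * Real.exp (4 * p ^ 2) := by
    have := Real.add_one_le_exp (4 * p ^ 2)
    have h3 : 1 / 4 ≤ (1 - c) ^ 2 := by nlinarith
    calc 1 - 2 * c + p ^ 2 ≤ (1 - c) ^ 2 * (4 * p ^ 2 + 1) := by nlinarith [sq_nonneg p, sq_nonneg c]
      _ ≤ _ := by gcongr
  rw [div_le_div_iff₀ (by positivity) (by positivity)]
  calc _ ≤ ((1 - c) ^ 2 * Real.exp (4 * p ^ 2)) ^ (N - 2 * r) * (1 - c) ^ (2 * r) := by gcongr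
    _ = Real.exp (4 * p ^ 2) ^ (N - 2 * r) * (1 - c) ^ (2 * (N - r)) := by
        rw [mul_pow, ← pow_mul, mul_right_comm, ← pow_add, mul_comm]
        congr 2
        omega
    _ ≤ _ := by
        refine mul_le_mul_of_nonneg_right ?_ (by positivity)
        rw [← Real.exp_nat_mul, Real.exp_le_exp]
        have : ((N - 2 * r : ℕ) : ℝ) ≤ N := by exact_mod_cast Nat.sub_le _ _
        have := mul_le_mul_of_nonneg_right this (show 0 ≤ 4 * p ^ 2 by positivity)
        linarith

/-- For `u ≤ 1 / 2` one has `1 - u ≥ exp (-(u + 2 u ^ 2))`, and `hN` bounds the accumulated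
second-order error by `1`. -/
theorem exp_le_one_sub_pow {u : ℝ} (hu : u ≤ 1 / 2) (N : ℕ) (hN : 2 * u * (N * u) ≤ 1) :
    Real.exp (-(N * u) - 1) ≤ (1 - u) ^ N := by
  have h1 : 0 < 1 - u := by linarith
  have h2 : Real.exp (-(u + 2 * u ^ 2)) ≤ 1 - u := by
    rw [Real.exp_neg, inv_le_comm₀ (Real.exp_pos _) h1]
    refine le_trans ?_ (Real.add_one_le_exp _)
    rw [inv_le_iff_one_le_mul₀ h1]
    nlinarith [mul_nonneg (sq_nonneg u) (show 0 ≤ 1 - 2 * u by linarith)]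
  calc _ ≤ Real.exp (-(u + 2 * u ^ 2)) ^ N := by
        rw [← Real.exp_nat_mul, Real.exp_le_exp]
        nlinarith
    _ ≤ _ := by gcongr

/-- The bound for the probability of robustness in terms of the mean degree `L`. -/
theorem probBinomialRIGRobust_le_of_meanDegree {k n P : ℕ} (hk : 1 ≤ k) {p : unitInterval} {L : ℝ}
    (hn : 2 ≤ n) (hL : L = n * ((p : ℝ) ^ 2 * P)) (hL1 : 1 ≤ L) (hη : n * (p : ℝ) * L ≤ 1 / 2)
    (hP : 2 * k ≤ P) :
    probBinomialRIGRobust k n P p ≤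
      8 ^ (k - 1) * (k - 1).factorial * Real.exp 1 * (n * L ^ (k - 1) * Real.exp (-L))⁻¹ +
      ((1 + 16 * (k - 1 : ℕ) / n) ^ (k - 1) *
        (Real.exp (4 * (L / n)) / (1 - n * (p : ℝ) * L) ^ (2 * (k - 1))) - 1) := by
  have h0 : (0 : ℝ) ≤ p := p.2.1
  have h1 : (p : ℝ) ≤ 1 := p.2.2
  set q : ℝ := (p : ℝ)
  have hn0 : (0 : ℝ) < n := by positivity
  have hP0 : (0 : ℝ) < P := by exact_mod_cast (by omega : 0 < P)
  have hL0 : 0 < L := by linarith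
  have hq : 0 < q := lt_of_le_of_ne h0 fun h => by
    rw [← h] at hL; simp at hL; linarith
  set r := k - 1
  have hnq : n * q ≤ n * q * L := le_mul_of_one_le_right (by positivity) hL1
  have hu1 : n * q ^ 2 ≤ n * q * L := by
    rw [sq, ← mul_assoc]
    exact (mul_le_of_le_one_right (by positivity) h1).trans hnq
  have hb := le_pairProb h0 h1 hn (hnq.trans hη)
  have hb0 : 0 < pairProb n q := lt_of_lt_of_le (by positivity) hb
  have hc0 := shareProb_nonneg h0 h1 n
  have hc := shareProb_le_mul_sq h0 h1 n
  have hd := not_share_prob_nonneg h0 h1 n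
  refine (probBinomialRIGRobust_le_shareCount hk hn P p).trans ?_
  have hmain := familyExp_shareCount_eq_zero_le (V := Fin n) (O := Fin P) (p := q) (r := r) h0 h1
  simp only [Fintype.card_fin] at hmain
  refine (hmain hb0 (by linarith) (by omega) (by omega) (by omega)).trans ?_
  set b := pairProb n q
  set c := shareProb n q
  refine add_le_add ?_ (sub_le_sub_right (mul_le_mul ?_ ?_ ?_ ?_) 1)
  -- Lower bound on the first moment: `8` is `2` from the binomial coefficient times `4` from
  -- `le_pairProb`, and `exp 1` comes from `exp_le_one_sub_pow`.
  · rw [← inv_inv (8 ^ r * (r.factorial : ℝ) * Real.exp 1), ← mul_inv]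
    refine inv_anti₀ (by positivity) ?_
    have hch : ((P : ℝ) / 2) ^ r / r.factorial ≤ P.choose r := by
      refine le_trans ?_ (Nat.pow_le_choose r P)
      gcongr
      rw [Nat.cast_sub (by omega)]
      have : 2 * (r : ℝ) ≤ P := by exact_mod_cast (by omega : 2 * r ≤ P)
      push_cast; linarith
    have hPb : L / 4 ≤ P * b := by
      calc L / 4 = P * (n * q ^ 2 / 4) := by rw [hL]; ring
        _ ≤ _ := by gcongr
    have hpow : Real.exp (-L - 1) ≤ (1 - c) ^ (P - r) := by
      have e : L = P * (n * q ^ 2) := by rw [hL]; ring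
      calc Real.exp (-L - 1) ≤ (1 - n * q ^ 2) ^ P := by
            rw [e]
            refine exp_le_one_sub_pow (by linarith) P ?_
            rw [← e]
            have : n * q ^ 2 * L ≤ n * q * L := by
              rw [sq, ← mul_assoc, mul_right_comm]
              exact mul_le_of_le_one_right (by positivity) h1
            linarith
        _ ≤ (1 - c) ^ P := pow_le_pow_left₀ (by linarith) (by linarith) P
        _ ≤ _ := pow_le_pow_of_le_one (by linarith) (by linarith) (Nat.sub_le _ _)
    calc (8 ^ r * (r.factorial : ℝ) * Real.exp 1)⁻¹ * (n * L ^ r * Real.exp (-L)) =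
          n * ((L / 4 / 2) ^ r / r.factorial * Real.exp (-L - 1)) := by
          rw [div_div, div_pow, sub_eq_add_neg, Real.exp_add, Real.exp_neg 1]
          norm_num
          field_simp
      _ ≤ n * ((P * b / 2) ^ r / r.factorial * (1 - c) ^ (P - r)) := by gcongr
      _ = n * ((P / 2) ^ r / r.factorial * (b ^ r * (1 - c) ^ (P - r))) := by
          rw [mul_div_right_comm, mul_pow]; ring
      _ ≤ _ := by
          have : 0 ≤ 1 - c := by linarith
          gcongr
  -- With `b ≥ n q ^ 2 / 4` the correlation per common object is at most `16 r / (n L)`, hence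
  -- negligible.
  · have hx : q ^ 2 / b ^ 2 * (r / P) ≤ 16 * r / n := by
      have h2 : (n * q ^ 2 / 4) ^ 2 ≤ b ^ 2 := by gcongr
      have h3 : q ^ 2 / b ^ 2 ≤ q ^ 2 / (n * q ^ 2 / 4) ^ 2 := by gcongr
      calc _ ≤ q ^ 2 / (n * q ^ 2 / 4) ^ 2 * (r / P) := by gcongr
        _ = 16 * r / n / L := by rw [hL]; field_simp; ring
        _ ≤ _ := div_le_self (by positivity) hL1
    gcongr
  · refine (not_share_pow_div_le (by linarith) hd (by omega)).trans ?_
    have e : q ^ 2 * P = L / n := by rw [hL]; field_simp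
    rw [e]
    have : 0 < 1 - n * q * L := by linarith
    gcongr
    linarith
  · have : 0 ≤ 1 - c := by linarith
    positivity
  · positivity

theorem tendsto_probBinomialRIGRobust_zero {k : ℕ} (hk : 1 ≤ k) {P : ℕ → ℕ} {p : ℕ → unitInterval}
    {α L : ℕ → ℝ} (hLp : ∀ n, L n = n * ((p n : ℝ) ^ 2 * P n))
    (hL : ∀ n : ℕ, 2 ≤ n → L n = Real.log n + ((k : ℝ) - 1) * Real.log (Real.log n) + α n)
    (hP : (fun n : ℕ => (n : ℝ) * Real.log n ^ 5) =O[atTop] (fun n : ℕ => (P n : ℝ)))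
    (hLlog : Tendsto (fun n : ℕ => L n / Real.log n) atTop (𝓝 1))
    (hα : Tendsto α atTop atBot) :
    Tendsto (fun n : ℕ => probBinomialRIGRobust k n (P n) (p n)) atTop (𝓝 0) := by
  have hη := tendsto_mul_prob_mul_meanDegree (fun n => (p n).2.1) hLp hLlog hP
  have hρ : Tendsto (fun n : ℕ => n * L n ^ (k - 1) * Real.exp (-L n)) atTop atTop := by
    have h1 : Tendsto (fun n => (L n / Real.log n) ^ (k - 1) * Real.exp (-α n)) atTop atTop :=
      (hLlog.pow (k - 1)).pos_mul_atTop (by norm_num)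
        (Real.tendsto_exp_atTop.comp (tendsto_neg_atBot_atTop.comp hα))
    refine h1.congr' ?_
    filter_upwards [eventually_ge_atTop 2] with n hn
    rw [exp_neg_meanDegree hk hL hn]
  have hbound : Tendsto (fun n : ℕ =>
      8 ^ (k - 1) * (k - 1).factorial * Real.exp 1 *
        (n * L n ^ (k - 1) * Real.exp (-L n))⁻¹ +
      ((1 + 16 * (k - 1 : ℕ) / (n : ℝ)) ^ (k - 1) *
        (Real.exp (4 * (L n / n)) / (1 - n * (p n : ℝ) * L n) ^ (2 * (k - 1))) - 1)) atTop (𝓝 0) := by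
    have a1 := (tendsto_inv_atTop_zero.comp hρ).const_mul
      (8 ^ (k - 1) * ((k - 1).factorial : ℝ) * Real.exp 1)
    have a2 : Tendsto (fun n : ℕ => (1 + 16 * (k - 1 : ℕ) / (n : ℝ)) ^ (k - 1)) atTop
        (𝓝 ((1 + 0) ^ (k - 1))) :=
      ((tendsto_const_div_atTop_nhds_zero_nat _).const_add 1).pow _
    have a3 : Tendsto (fun n : ℕ => Real.exp (4 * (L n / n))) atTop (𝓝 (Real.exp (4 * 0))) := by
      have := tendsto_pow_meanDegree_div hLlog 1
      simp only [pow_one] at this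
      exact (Real.continuous_exp.tendsto _).comp (this.const_mul 4)
    have a4 : Tendsto (fun n : ℕ => (1 - n * (p n : ℝ) * L n) ^ (2 * (k - 1))) atTop
        (𝓝 ((1 - 0) ^ (2 * (k - 1)))) := (hη.const_sub 1).pow _
    have := a1.add ((a2.mul (a3.div a4 (by norm_num))).sub_const 1)
    simpa using this
  refine squeeze_zero' (Eventually.of_forall fun n => measureReal_nonneg) ?_ hbound
  filter_upwards [eventually_ge_atTop 2, (tendsto_meanDegree_atTop hLlog).eventually_ge_atTop 1,
    hη.eventually_le_const (show (0 : ℝ) < 1 / 2 by norm_num),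
    (tendsto_poolSize hP).eventually_ge_atTop (2 * k)] with n hn h1 h2 h3
  exact probBinomialRIGRobust_le_of_meanDegree hk hn (hLp n) h1 h2 h3

end Limits

theorem theorem5 (k : ℕ) (hk : 1 ≤ k) (P : ℕ → ℕ) (p : ℕ → unitInterval) (α : ℕ → ℝ)
    (hα : ∀ n : ℕ, 2 ≤ n →
      (p n : ℝ) ^ 2 * (P n : ℝ) =
        (Real.log n + ((k : ℝ) - 1) * Real.log (Real.log n) + α n) / n)
    (hP : (fun n : ℕ => (n : ℝ) * Real.log n ^ 5) =O[atTop] (fun n : ℕ => (P n : ℝ)))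
    (hαo : (fun n : ℕ => |α n|) =o[atTop] (fun n : ℕ => Real.log n)) :
    (Tendsto α atTop atBot →
      Tendsto (fun n : ℕ => probBinomialRIGRobust k n (P n) (p n)) atTop (𝓝 0)) ∧
    (Tendsto α atTop atTop →
      Tendsto (fun n : ℕ => probBinomialRIGRobust k n (P n) (p n)) atTop (𝓝 1)) := by
  have hL : ∀ n : ℕ, 2 ≤ n → (n : ℝ) * ((p n : ℝ) ^ 2 * P n) =
      Real.log n + ((k : ℝ) - 1) * Real.log (Real.log n) + α n := by
    intro n hn
    rw [hα n hn, mul_div_cancel₀]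
    positivity
  have hLlog := tendsto_meanDegree_div_log (L := fun n : ℕ => n * ((p n : ℝ) ^ 2 * P n)) hL hαo
  exact ⟨tendsto_probBinomialRIGRobust_zero hk (fun _ => rfl) hL hP hLlog,
    tendsto_probBinomialRIGRobust_one hk (fun _ => rfl) hL hP hLlog⟩
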